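/- Let $1<p<\infty$ and $\theta=1/p$. For a Banach pair $\vec X=(X_0,X_1)$ (two Banach spaces over the same field $\mathbb R$ or $\mathbb C$, continuously embedded in a common Hausdorff topological vector space), put, for $f\in X_0+X_1$ and $t>0$, $$K(t,f)=\inf\{\|f_0\|_{X_0}+t\|f_1\|_{X_1}: f=f_0+f_1,\ f_i\in X_i\},\qquad \|f\|_{\vec X_{\eta,q}}=\Big\{\int_0^\infty\big[t^{-\eta}K(t,f)\big]^q\frac{dt}{t}\Big\}^{1/q},$$ $$\vec X_{\eta,q}=\{f\in X_0+X_1:\|f\|_{\vec X_{\eta,q}}<\infty\},\qquad \|f\|_{\vec X^{(1)}_{1,\infty}}=\operatorname*{ess\,sup}_{t>0}\Big[\frac{K(t,f)}{t}-K'(t,f)\Big].$$ (i) There is a constant $C$, depending only on $p$, such that for every Banach pair $\vec X$ and every $f\in\vec X_{1-\theta,p}$, $$\|f\|_{\vec X_{1-\theta/2,2p}}\le C\,\|f\|_{\vec X_{1-\theta,p}}^{1/2}\,\|f\|_{\vec X^{(1)}_{1,\infty}}^{1/2}.$$ (ii) There is a constant $C$, depending only on $p$, such that the following holds for every Banach pair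 $\vec X=(X_0,X_1)$ and every bilinear operator $\Pi_1$ of product type on it, that is, $\Pi_1$ is bounded and bilinear $X_1\times X_1\to X_1$, $X_1\times X_0\to X_0$ and $X_0\times X_1\to X_0$ (the three restrictions agreeing wherever two of them apply), the largest of the three norms being $M$. The operator $\Pi_1$ has a unique bounded bilinear extension $\vec X_{1-\theta/2,2p}\times\vec X_{1-\theta/2,2p}\to\vec X_{1-\theta,p}$ (an extension being required to agree with $\Pi_1$ on the pairs $(f,g)$ for which one of $f,g$ lies in $X_1$ and the other one in $X_0+X_1$), it satisfies $$\|\Pi_1(f,g)\|_{\vec X_{1-\theta,p}}\le C\,M\,\|f\|_{\vec X_{1-\theta/2,2p}}\|g\|_{\vec X_{1-\theta/2,2p}},$$ and all $f,g\in\vec X_{1-\theta,p}$ with $\|f\|_{\vec X^{(1)}_{1,\infty}},\|g\|_{\vec X^{(1)}_{1,\infty}}<\infty$ belong to $\vec X_{1-\theta/2,2p}$ and satisfy $$\|\Pi_1(f,g)\|_{\vec X_{1-\theta,p}}\le C\,M\,\big(\|f\|_{\vec X_{1-\theta,p}}\|g\|_{\vec X^{(1)}_{1,\infty}}+\|g\|_{\vec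 X_{1-\theta,p}}\|f\|_{\vec X^{(1)}_{1,\infty}}\big).$$ (iii) There is a constant $C$, depending only on $p$, such that for every measure space and all scalar (real or complex) functions $f,g\in L^p$, $$\|fg\|_{L^p}\le C\big(\|f\|_{L^p}\|g\|_{L(\infty,\infty)}+\|g\|_{L^p}\|f\|_{L(\infty,\infty)}\big),\qquad \|f\|_{L(\infty,\infty)}=\sup_{t>0}\{f^{**}(t)-f^*(t)\},$$ where $f^*$ is the non-increasing rearrangement of $f$, $f^{**}(t)=\frac1t\int_0^tf^*(s)\,ds$, and $0\cdot\infty=0$. -/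

import Mathlib

open MeasureTheory Set
open scoped ENNReal NNReal

noncomputable section

/-- A Banach pair `(X₀, X₁)`: two Banach spaces continuously embedded in a common Hausdorff
topological vector space `V` (completeness of `X₀`, `X₁` and separation of `V` are type-class
assumptions wherever a pair is used). -/
structure BanachPair (𝕜 V X₀ X₁ : Type*) [RCLike 𝕜]
    [AddCommGroup V] [Module 𝕜 V] [TopologicalSpace V]
    [NormedAddCommGroup X₀] [NormedSpace 𝕜 X₀]
    [NormedAddCommGroup X₁] [NormedSpace 𝕜 X₁] where
  /-- the embedding of `X₀` -/
  i₀ : X₀ →L[𝕜] V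
  /-- the embedding of `X₁` -/
  i₁ : X₁ →L[𝕜] V
  inj₀ : Function.Injective i₀
  inj₁ : Function.Injective i₁

/-- The measure `dt / t` on `(0, ∞)`, as a measure on `ℝ`. -/
def dtOverT : Measure ℝ :=
  (volume.restrict (Ioi (0 : ℝ))).withDensity fun t => ENNReal.ofReal t⁻¹

namespace BanachPair

variable {𝕜 V X₀ X₁ : Type*} [RCLike 𝕜]
  [AddCommGroup V] [Module 𝕜 V] [TopologicalSpace V]
  [NormedAddCommGroup X₀] [NormedSpace 𝕜 X₀]
  [NormedAddCommGroup X₁] [NormedSpace 𝕜 X₁]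

/-- The `K`-functional `K(t, f; X₀, X₁)`, for `t > 0`. It is finite exactly on `X₀ + X₁`
(an infimum over the empty set is `∞`). -/
def K (X : BanachPair 𝕜 V X₀ X₁) (t : ℝ) (f : V) : ℝ≥0∞ :=
  ⨅ (x₀ : X₀) (x₁ : X₁) (_ : X.i₀ x₀ + X.i₁ x₁ = f), ‖x₀‖ₑ + ENNReal.ofReal t * ‖x₁‖ₑ

/-- The functional `‖f‖_{θ,q} = {∫₀^∞ (t^{-θ} K(t, f))^q dt/t}^{1/q}`, with the usual
modification for `q = ∞`. It is `∞` outside `X₀ + X₁`. -/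
def interpNorm (X : BanachPair 𝕜 V X₀ X₁) (θ : ℝ) (q : ℝ≥0∞) (f : V) : ℝ≥0∞ :=
  eLpNorm (fun t : ℝ => ENNReal.ofReal (t ^ (-θ)) * X.K t f) q dtOverT

/-- The functional of the first Gagliardo coordinate space,
`{∫₀^∞ (t^{1-θ} [K(t, f)/t - K'(t, f)])^q dt/t}^{1/q}` for `f ∈ X₀ + X₁`, with the usual
modification (essential supremum) for `q = ∞`. For `f ∈ X₀ + X₁` the function `K(·, f)` is finite
and concave on `(0, ∞)`, so it is differentiable off a countable set, which does not matter here. -/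
def gagliardoNorm₁ (X : BanachPair 𝕜 V X₀ X₁) (θ : ℝ) (q : ℝ≥0∞) (f : V) : ℝ≥0∞ :=
  eLpNorm (fun t : ℝ =>
    t ^ (1 - θ) * ((X.K t f).toReal / t - deriv (fun s : ℝ => (X.K s f).toReal) t)) q dtOverT

theorem K_add_le (X : BanachPair 𝕜 V X₀ X₁) (t : ℝ) (f g : V) :
    X.K t (f + g) ≤ X.K t f + X.K t g := by
  unfold K
  simp only [ENNReal.iInf_add, ENNReal.add_iInf]
  refine le_iInf fun a₀ => le_iInf fun a₁ => le_iInf fun ha => le_iInf fun b₀ => le_iInf fun b₁ =>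
    le_iInf fun hb => ?_
  have h : X.i₀ (a₀ + b₀) + X.i₁ (a₁ + b₁) = f + g := by
    rw [← ha, ← hb, map_add, map_add]; abel
  refine (iInf_le_of_le (a₀ + b₀) (iInf_le_of_le (a₁ + b₁) (iInf_le _ h))).trans ?_
  calc ‖a₀ + b₀‖ₑ + ENNReal.ofReal t * ‖a₁ + b₁‖ₑ
      ≤ (‖a₀‖ₑ + ‖b₀‖ₑ) + ENNReal.ofReal t * (‖a₁‖ₑ + ‖b₁‖ₑ) := by
        gcongr <;> exact enorm_add_le _ _
    _ = _ := by ring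

theorem K_smul_le (X : BanachPair 𝕜 V X₀ X₁) (t : ℝ) (c : 𝕜) (f : V) :
    X.K t (c • f) ≤ ‖c‖ₑ * X.K t f := by
  have key : ∀ x₀ x₁, X.i₀ x₀ + X.i₁ x₁ = f →
      X.K t (c • f) ≤ ‖c‖ₑ * (‖x₀‖ₑ + ENNReal.ofReal t * ‖x₁‖ₑ) := by
    intro x₀ x₁ h
    have h' : X.i₀ (c • x₀) + X.i₁ (c • x₁) = c • f := by
      rw [← h, map_smul, map_smul, smul_add]
    refine (iInf_le_of_le (c • x₀) (iInf_le_of_le (c • x₁) (iInf_le _ h'))).trans ?_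
    rw [enorm_smul, enorm_smul]
    exact le_of_eq (by ring)
  rcases eq_or_ne c 0 with rfl | hc
  · exact (iInf_le_of_le (0 : X₀) (iInf_le_of_le (0 : X₁) (iInf_le _ (by simp)))).trans (by simp)
  · have hc0 : ‖c‖ₑ ≠ 0 := by simpa using hc
    have hct : ‖c‖ₑ ≠ ∞ := enorm_ne_top
    rw [show X.K t f = ⨅ (x₀ : X₀) (x₁ : X₁) (_ : X.i₀ x₀ + X.i₁ x₁ = f),
      ‖x₀‖ₑ + ENNReal.ofReal t * ‖x₁‖ₑ from rfl, ENNReal.mul_iInf_of_ne hc0 hct]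
    refine le_iInf fun x₀ => ?_
    rw [ENNReal.mul_iInf_of_ne hc0 hct]
    refine le_iInf fun x₁ => ?_
    rw [ENNReal.mul_iInf_of_ne hc0 hct]
    exact le_iInf fun h => key x₀ x₁ h

theorem measurable_interp (X : BanachPair 𝕜 V X₀ X₁) (θ : ℝ) (f : V) :
    AEStronglyMeasurable (fun t : ℝ => ENNReal.ofReal (t ^ (-θ)) * X.K t f) dtOverT := by
  have hK : Monotone fun t : ℝ => X.K t f := by
    intro s t hst
    refine iInf_mono fun x₀ => iInf_mono fun x₁ => iInf_mono fun _ => ?_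
    gcongr
  have h : Measurable fun t : ℝ => ENNReal.ofReal (t ^ (-θ)) :=
    ENNReal.measurable_ofReal.comp (measurable_id.pow_const _)
  exact (h.mul hK.measurable).aestronglyMeasurable

/-- The real interpolation space `X_{θ,q}`, as a linear subspace of `V`. -/
def interpSpace (X : BanachPair 𝕜 V X₀ X₁) (θ : ℝ) (q : ℝ≥0∞) : Submodule 𝕜 V where
  carrier := {f | X.interpNorm θ q f < ∞}
  zero_mem' := by
    have h0 : ∀ t, X.K t 0 = 0 := fun t => by
      simpa using X.K_smul_le t (0 : 𝕜) 0
    have : (fun t : ℝ => ENNReal.ofReal (t ^ (-θ)) * X.K t 0) = 0 := by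
      funext t; simp [h0]
    simp [interpNorm, this]
  add_mem' := by
    intro f g hf hg
    refine lt_of_le_of_lt (eLpNorm_mono_enorm fun t => ?_)
      (eLpNorm_add_lt_top ⟨X.measurable_interp θ f, hf⟩ ⟨X.measurable_interp θ g, hg⟩)
    simp only [enorm_eq_self, Pi.add_apply, ← mul_add]
    gcongr
    exact X.K_add_le t f g
  smul_mem' := by
    intro c f hf
    have h : X.interpNorm θ q (c • f) ≤ (‖c‖₊ : ℝ≥0∞) * X.interpNorm θ q f := by
      refine eLpNorm_le_mul_eLpNorm_of_ae_le_mul' (Filter.Eventually.of_forall fun t => ?_) q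
      simp only [enorm_eq_self]
      rw [mul_left_comm]
      gcongr
      exact X.K_smul_le t c f
    exact h.trans_lt (ENNReal.mul_lt_top ENNReal.coe_lt_top hf)

/-- A bounded bilinear operator `Π` of product type on the pair `(X₀, X₁)`:
`X₁ × X₁ → X₁`, `X₁ × X₀ → X₀`, `X₀ × X₁ → X₀`. It is given by its three bounded restrictions, which
have to agree in `V` wherever two of them apply. -/
structure ProductOperator (X : BanachPair 𝕜 V X₀ X₁) where
  m₁₁ : X₁ →L[𝕜] X₁ →L[𝕜] X₁
  m₁₀ : X₁ →L[𝕜] X₀ →L[𝕜] X₀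
  m₀₁ : X₀ →L[𝕜] X₁ →L[𝕜] X₀
  compat_right : ∀ (a b : X₁) (b' : X₀), X.i₁ b = X.i₀ b' → X.i₁ (m₁₁ a b) = X.i₀ (m₁₀ a b')
  compat_left : ∀ (a b : X₁) (a' : X₀), X.i₁ a = X.i₀ a' → X.i₁ (m₁₁ a b) = X.i₀ (m₀₁ a' b)

namespace ProductOperator

variable {X : BanachPair 𝕜 V X₀ X₁}

/-- The largest of the norms of the three restrictions. -/
def bound (P : X.ProductOperator) : ℝ≥0 := max ‖P.m₁₁‖₊ (max ‖P.m₁₀‖₊ ‖P.m₀₁‖₊)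

/-- `T`, a bilinear map on the subspace `S` of `V` with values in the subspace `R`, extends `Π`:
`T(f, g) = Π(f, g)` whenever `f, g ∈ S`, one of `f, g` is in `X₁` and the other one in `X₀ + X₁`. -/
def IsExtension (P : X.ProductOperator) {S R : Submodule 𝕜 V} (T : S →ₗ[𝕜] S →ₗ[𝕜] R) : Prop :=
  (∀ (f g : S) (a : X₁) (b₀ : X₀) (b₁ : X₁), (f : V) = X.i₁ a → (g : V) = X.i₀ b₀ + X.i₁ b₁ →
    (T f g : V) = X.i₀ (P.m₁₀ a b₀) + X.i₁ (P.m₁₁ a b₁)) ∧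
  (∀ (f g : S) (a₀ : X₀) (a₁ : X₁) (b : X₁), (f : V) = X.i₀ a₀ + X.i₁ a₁ → (g : V) = X.i₁ b →
    (T f g : V) = X.i₀ (P.m₀₁ a₀ b) + X.i₁ (P.m₁₁ a₁ b))

end ProductOperator

end BanachPair

variable {Ω E : Type*} [MeasurableSpace Ω] [NormedAddCommGroup E]

/-- The non-increasing rearrangement `f*(t) = inf {s ≥ 0 : μ{|f| > s} ≤ t}`, for `t > 0`. -/
def rearrangement (f : Ω → E) (μ : Measure Ω) (t : ℝ) : ℝ≥0∞ :=
  sInf {s : ℝ≥0∞ | μ {x | s < ‖f x‖ₑ} ≤ ENNReal.ofReal t}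

/-- `f**(t) = (1/t) ∫₀^t f*(s) ds`, for `t > 0`. -/
def maximalRearrangement (f : Ω → E) (μ : Measure Ω) (t : ℝ) : ℝ≥0∞ :=
  (ENNReal.ofReal t)⁻¹ * ∫⁻ s in Ioc 0 t, rearrangement f μ s

/-- `‖f‖_{L(∞,∞)} = sup_{t > 0} {f**(t) - f*(t)}`. Note that `f* ≤ f**`. -/
def normLInftyInfty (f : Ω → E) (μ : Measure Ω) : ℝ≥0∞ :=
  ⨆ (t : ℝ) (_ : 0 < t), maximalRearrangement f μ t - rearrangement f μ t

end

/-! Put F(t) = K(t, f) / t, a non-increasing function. With θ = 1/p the norms of X_{1-θ,p} and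
X_{1-θ/2,2p} are the L^p(dt) and L^{2p}(dt) norms of F on (0, ∞), so (i) becomes a statement about
one function. Since F' = -(K/t - K')/t, the Gagliardo norm γ bounds the drop F(t) - F(2t) by γ log 2
≤ γ (`avg_le_avg_two_mul_add`). A function with such a bound gains integrability
(`exists_lintegral_rpow_two_mul_le`): either F(2t) is comparable to F(t), and the dilation identity
∫ F(2t)^{2p} dt = ½ ∫ F^{2p} dt lets this contribution be absorbed, or F(t) is at most a multiple of
γ and F^{2p} is at most a multiple of γ^p F^p.

For (ii), take a, b in X₁ with averages F, G. Decomposing both almost optimally at the scales 2^{-n}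
t and telescoping bounds the average of the product by a multiple of M Σ 2^{-n} F(2^{-n} t) G(2^{-n}
t) (`avg_m₁₁_le`). Hardy's inequality (`exists_hardy_dyadic`, where p > 1 enters) and Cauchy–Schwarz
turn this into a bound L^{2p} × L^{2p} → L^p. The elements of X₁ are dense in the source space and
the target is complete, so there is exactly one bounded extension; continuity shows that it is still
the given product on X₁ × (X₀ + X₁) (`extension_right`). The Gagliardo form of the bound is (i)
applied to both factors.

For (iii) the same integrability gain applies to f*, since f*(t) ≤ f*(2t) + 2 ‖f‖_{L(∞,∞)}
(`rearrangement_le_two_mul_add`); equimeasurability and Cauchy–Schwarz for fg finish the proof. -/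

namespace BanachPair

/-! ### The `K`-functional, almost optimal decompositions and the average K(t, f) / t -/

section KFunctional

variable {𝕜 V X₀ X₁ : Type*} [RCLike 𝕜]
  [AddCommGroup V] [Module 𝕜 V] [TopologicalSpace V]
  [NormedAddCommGroup X₀] [NormedSpace 𝕜 X₀]
  [NormedAddCommGroup X₁] [NormedSpace 𝕜 X₁]

theorem K_le (X : BanachPair 𝕜 V X₀ X₁) (t : ℝ) {f : V} {x₀ : X₀} {x₁ : X₁}
    (h : X.i₀ x₀ + X.i₁ x₁ = f) : X.K t f ≤ ‖x₀‖ₑ + ENNReal.ofReal t * ‖x₁‖ₑ :=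
  iInf_le_of_le x₀ (iInf_le_of_le x₁ (iInf_le _ h))

theorem K_i₀_le (X : BanachPair 𝕜 V X₀ X₁) (t : ℝ) (x₀ : X₀) : X.K t (X.i₀ x₀) ≤ ‖x₀‖ₑ := by
  simpa using X.K_le t (show X.i₀ x₀ + X.i₁ 0 = X.i₀ x₀ by simp)

theorem K_i₁_le (X : BanachPair 𝕜 V X₀ X₁) (t : ℝ) (x₁ : X₁) :
    X.K t (X.i₁ x₁) ≤ ENNReal.ofReal t * ‖x₁‖ₑ := by
  simpa using X.K_le t (show X.i₀ 0 + X.i₁ x₁ = X.i₁ x₁ by simp)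

theorem K_mono (X : BanachPair 𝕜 V X₀ X₁) (f : V) : Monotone fun t : ℝ => X.K t f := by
  intro s t hst
  refine iInf_mono fun x₀ => iInf_mono fun x₁ => iInf_mono fun _ => ?_
  gcongr

theorem K_neg_le (X : BanachPair 𝕜 V X₀ X₁) (t : ℝ) (f : V) : X.K t (-f) ≤ X.K t f := by
  simpa using X.K_smul_le t (-1 : 𝕜) f

theorem K_sub_le (X : BanachPair 𝕜 V X₀ X₁) (t : ℝ) (f g : V) :
    X.K t (f - g) ≤ X.K t f + X.K t g := by
  rw [sub_eq_add_neg]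
  exact (X.K_add_le t _ _).trans (by gcongr; exact X.K_neg_le t g)

theorem exists_lt_of_K_lt (X : BanachPair 𝕜 V X₀ X₁) {t : ℝ} {f : V} {c : ℝ≥0∞}
    (h : X.K t f < c) :
    ∃ x₀ x₁, X.i₀ x₀ + X.i₁ x₁ = f ∧ ‖x₀‖ₑ + ENNReal.ofReal t * ‖x₁‖ₑ < c := by
  simp only [K, iInf_lt_iff] at h
  obtain ⟨x₀, x₁, h, h'⟩ := h
  exact ⟨x₀, x₁, h, h'⟩

theorem K_ne_top_iff (X : BanachPair 𝕜 V X₀ X₁) {t : ℝ} {f : V} :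
    X.K t f ≠ ∞ ↔ ∃ x₀ x₁, X.i₀ x₀ + X.i₁ x₁ = f := by
  refine ⟨fun h => ?_, fun ⟨x₀, x₁, h⟩ => ?_⟩
  · obtain ⟨x₀, x₁, h, -⟩ := X.exists_lt_of_K_lt (lt_top_iff_ne_top.2 h)
    exact ⟨x₀, x₁, h⟩
  · refine ((X.K_le t h).trans_lt ?_).ne
    exact ENNReal.add_lt_top.2
      ⟨enorm_lt_top, ENNReal.mul_lt_top ENNReal.ofReal_lt_top enorm_lt_top⟩

/-- Decompositions of cost below 1/n have both parts tending to 0, hence so do their images in `V`;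
but each sum is f, and limits in `V` are unique. -/
theorem eq_zero_of_K_eq_zero [IsTopologicalAddGroup V] [T2Space V] (X : BanachPair 𝕜 V X₀ X₁)
    {t : ℝ} (ht : 0 < t) {f : V} (h : X.K t f = 0) : f = 0 := by
  have h1 : ∀ n : ℕ, ∃ x₀ x₁, X.i₀ x₀ + X.i₁ x₁ = f ∧
      ‖x₀‖ₑ + ENNReal.ofReal t * ‖x₁‖ₑ < (n : ℝ≥0∞)⁻¹ := fun n =>
    X.exists_lt_of_K_lt (by rw [h]; simp)
  choose x₀ x₁ hx hlt using h1
  have hinv : Filter.Tendsto (fun n : ℕ => (n : ℝ≥0∞)⁻¹) Filter.atTop (nhds 0) :=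
    ENNReal.tendsto_inv_nat_nhds_zero
  have h0 : Filter.Tendsto x₀ Filter.atTop (nhds 0) := by
    rw [tendsto_zero_iff_enorm_tendsto_zero]
    exact tendsto_of_tendsto_of_tendsto_of_le_of_le tendsto_const_nhds hinv
      (fun _ => zero_le) (fun n => le_self_add.trans (hlt n).le)
  have ht0 : ENNReal.ofReal t ≠ 0 := by simpa using ht
  have h1 : Filter.Tendsto x₁ Filter.atTop (nhds 0) := by
    rw [tendsto_zero_iff_enorm_tendsto_zero]
    have := ENNReal.Tendsto.const_mul (a := (ENNReal.ofReal t)⁻¹) hinv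
      (Or.inr (ENNReal.inv_ne_top.2 ht0))
    rw [mul_zero] at this
    refine tendsto_of_tendsto_of_tendsto_of_le_of_le tendsto_const_nhds this
      (fun _ => zero_le) (fun n => ?_)
    have h2 : ENNReal.ofReal t * ‖x₁ n‖ₑ ≤ (n : ℝ≥0∞)⁻¹ := le_add_self.trans (hlt n).le
    calc ‖x₁ n‖ₑ = (ENNReal.ofReal t)⁻¹ * (ENNReal.ofReal t * ‖x₁ n‖ₑ) := by
          rw [← mul_assoc, ENNReal.inv_mul_cancel ht0 ENNReal.ofReal_ne_top, one_mul]
      _ ≤ _ := by gcongr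
  have h2 : Filter.Tendsto (fun n => X.i₀ (x₀ n) + X.i₁ (x₁ n)) Filter.atTop (nhds (0 + 0)) := by
    refine Filter.Tendsto.add ?_ ?_
    · have := (X.i₀.continuous.tendsto 0).comp h0
      rwa [map_zero] at this
    · have := (X.i₁.continuous.tendsto 0).comp h1
      rwa [map_zero] at this
  simp only [hx, add_zero] at h2
  exact tendsto_nhds_unique tendsto_const_nhds h2

/-- An almost optimal decomposition for the `K`-functional. -/
theorem exists_decomposition [IsTopologicalAddGroup V] [T2Space V] (X : BanachPair 𝕜 V X₀ X₁)
    {t : ℝ} (ht : 0 < t) {f : V} (h : X.K t f ≠ ∞) :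
    ∃ x₀ x₁, X.i₀ x₀ + X.i₁ x₁ = f ∧ ‖x₀‖ₑ + ENNReal.ofReal t * ‖x₁‖ₑ ≤ 2 * X.K t f := by
  -- The factor 2 leaves room for a near-minimiser only when K > 0; for K = 0 the vector itself
  -- vanishes.
  by_cases h0 : X.K t f = 0
  · refine ⟨0, 0, ?_, by simp⟩
    simpa using (X.eq_zero_of_K_eq_zero ht h0).symm
  · obtain ⟨x₀, x₁, hx, hlt⟩ := X.exists_lt_of_K_lt (c := 2 * X.K t f)
      (by rw [two_mul]; exact ENNReal.lt_add_right h h0)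
    exact ⟨x₀, x₁, hx, hlt.le⟩

/-- The average `K(t, f) / t`. -/
noncomputable def avg (X : BanachPair 𝕜 V X₀ X₁) (t : ℝ) (f : V) : ℝ≥0∞ :=
  X.K t f / ENNReal.ofReal t

theorem ofReal_mul_avg (X : BanachPair 𝕜 V X₀ X₁) {t : ℝ} (ht : 0 < t) (f : V) :
    ENNReal.ofReal t * X.avg t f = X.K t f :=
  ENNReal.mul_div_cancel (by simpa using ht) ENNReal.ofReal_ne_top

/-- For s ≤ t every decomposition satisfies (s/t)(‖x₀‖ + t‖x₁‖) ≤ ‖x₀‖ + s‖x₁‖. -/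
theorem avg_antitoneOn (X : BanachPair 𝕜 V X₀ X₁) (f : V) :
    AntitoneOn (fun t => X.avg t f) (Ioi 0) := by
  intro s hs t (ht' : 0 < t) hst
  have hs' : 0 < s := hs
  have key : ENNReal.ofReal (s / t) * X.K t f ≤ X.K s f := by
    refine le_iInf fun x₀ => le_iInf fun x₁ => le_iInf fun h => ?_
    refine (mul_le_mul_right (X.K_le t h) _).trans ?_
    rw [mul_add, ← mul_assoc, ← ENNReal.ofReal_mul (by positivity), div_mul_cancel₀ _ ht'.ne']
    gcongr
    refine mul_le_of_le_one_left' ?_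
    rw [ENNReal.ofReal_le_one]
    exact (div_le_one ht').2 hst
  have hs0 : ENNReal.ofReal s ≠ 0 := by simpa using hs
  simp only [avg]
  rw [ENNReal.le_div_iff_mul_le (Or.inl hs0) (Or.inl ENNReal.ofReal_ne_top)]
  refine le_trans (le_of_eq ?_) key
  rw [ENNReal.ofReal_div_of_pos ht', div_eq_mul_inv, div_eq_mul_inv]
  ring

theorem measurable_avg (X : BanachPair 𝕜 V X₀ X₁) (f : V) : Measurable fun t => X.avg t f :=
  (X.K_mono f).measurable.div ENNReal.measurable_ofReal

theorem avg_add_le (X : BanachPair 𝕜 V X₀ X₁) (t : ℝ) (f g : V) :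
    X.avg t (f + g) ≤ X.avg t f + X.avg t g := by
  simp only [avg, ← ENNReal.add_div]
  gcongr
  exact X.K_add_le t f g

theorem avg_i₁_le (X : BanachPair 𝕜 V X₀ X₁) (t : ℝ) (x₁ : X₁) :
    X.avg t (X.i₁ x₁) ≤ ‖x₁‖ₑ :=
  ENNReal.div_le_of_le_mul ((X.K_i₁_le t x₁).trans_eq (mul_comm _ _))

/-- An almost optimal decomposition, with separate bounds for the two parts. -/
theorem exists_decomposition_avg [IsTopologicalAddGroup V] [T2Space V]
    (X : BanachPair 𝕜 V X₀ X₁) {t : ℝ} (ht : 0 < t) {f : V} (h : X.K t f ≠ ∞) :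
    ∃ x₀ x₁, X.i₀ x₀ + X.i₁ x₁ = f ∧ ‖x₀‖ₑ ≤ 2 * X.K t f ∧ ‖x₁‖ₑ ≤ 2 * X.avg t f := by
  obtain ⟨x₀, x₁, hx, hle⟩ := X.exists_decomposition ht h
  have ht0 : ENNReal.ofReal t ≠ 0 := by simpa using ht
  refine ⟨x₀, x₁, hx, le_self_add.trans hle, ?_⟩
  rw [avg, ← mul_div_assoc, ENNReal.le_div_iff_mul_le (Or.inl ht0) (Or.inl ENNReal.ofReal_ne_top),
    mul_comm]
  exact le_add_self.trans hle

end KFunctional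

end BanachPair

/-! ### Integration on (0, ∞): Minkowski for series, dilations, the measure dt/t -/

/-- Minkowski's inequality for a series of non-negative functions. -/
theorem lintegral_Lp_tsum_le {α : Type*} [MeasurableSpace α] {μ : Measure α} {q : ℝ} (hq : 1 ≤ q)
    {φ : ℕ → α → ℝ≥0∞} (hφ : ∀ n, Measurable (φ n)) :
    (∫⁻ x, (∑' n, φ n x) ^ q ∂μ) ^ (1 / q) ≤ ∑' n, (∫⁻ x, φ n x ^ q ∂μ) ^ (1 / q) := by
  have hq0 : 0 < q := by linarith
  have hfin : ∀ N : ℕ, (∫⁻ x, (∑ n ∈ Finset.range N, φ n x) ^ q ∂μ) ^ (1 / q) ≤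
      ∑ n ∈ Finset.range N, (∫⁻ x, φ n x ^ q ∂μ) ^ (1 / q) := by
    intro N
    induction N with
    | zero => simp [hq0]
    | succ N ih =>
      simp only [Finset.sum_range_succ]
      refine (ENNReal.lintegral_Lp_add_le
        (Finset.measurable_fun_sum _ fun n _ => hφ n).aemeasurable (hφ N).aemeasurable hq).trans ?_
      gcongr
  have hsup : ∀ x, (∑' n, φ n x) ^ q = ⨆ N : ℕ, (∑ n ∈ Finset.range N, φ n x) ^ q := by
    intro x
    rw [ENNReal.tsum_eq_iSup_nat]
    exact (ENNReal.orderIsoRpow q hq0).map_iSup _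
  simp only [hsup]
  rw [lintegral_iSup (fun N => (Finset.measurable_fun_sum _ fun n _ => hφ n).pow_const q)]
  · have h1 := (ENNReal.orderIsoRpow (1 / q) (by positivity)).map_iSup
      (fun N : ℕ => ∫⁻ x, (∑ n ∈ Finset.range N, φ n x) ^ q ∂μ)
    simp only [ENNReal.orderIsoRpow_apply] at h1
    rw [h1]
    exact iSup_le fun N => (hfin N).trans (ENNReal.sum_le_tsum _)
  · intro N M hNM x
    dsimp only
    gcongr

theorem setLIntegral_Ioi_comp_mul_left {c : ℝ} (hc : 0 < c) (φ : ℝ → ℝ≥0∞) :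
    ∫⁻ t in Ioi 0, φ (c * t) = ENNReal.ofReal c⁻¹ * ∫⁻ t in Ioi 0, φ t := by
  have he : MeasurableEmbedding (fun t : ℝ => c * t) :=
    (Homeomorph.mulLeft₀ c hc.ne').measurableEmbedding
  have hpre : (fun t : ℝ => c * t) ⁻¹' Ioi 0 = Ioi 0 := by
    ext t; simp [hc]
  have h := he.lintegral_map (μ := volume.restrict (Ioi 0)) φ
  rw [← hpre, ← he.restrict_map, hpre, Real.map_volume_mul_left hc.ne', Measure.restrict_smul,
    lintegral_smul_measure,
    abs_of_pos (inv_pos.2 hc)] at h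
  simpa using h.symm

theorem lintegral_dtOverT (φ : ℝ → ℝ≥0∞) :
    ∫⁻ t, φ t ∂dtOverT = ∫⁻ t in Ioi 0, ENNReal.ofReal t⁻¹ * φ t := by
  rw [dtOverT, lintegral_withDensity_eq_lintegral_mul_non_measurable]
  · rfl
  · fun_prop
  · exact Filter.Eventually.of_forall fun t => ENNReal.ofReal_lt_top

theorem ae_dtOverT {P : ℝ → Prop} (h : ∀ᵐ t ∂dtOverT, P t) :
    ∀ᵐ t ∂(volume.restrict (Ioi (0 : ℝ))), P t := by
  rw [dtOverT, ae_withDensity_iff (by fun_prop)] at h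
  filter_upwards [h, ae_restrict_mem measurableSet_Ioi] with t ht ht0
  exact ht (by simpa using ht0)

namespace BanachPair

/-! ### The interpolation norm as an L^q norm of the average -/

section InterpolationNorm

variable {𝕜 V X₀ X₁ : Type*} [RCLike 𝕜]
  [AddCommGroup V] [Module 𝕜 V] [TopologicalSpace V]
  [NormedAddCommGroup X₀] [NormedSpace 𝕜 X₀]
  [NormedAddCommGroup X₁] [NormedSpace 𝕜 X₁]

/-- The norm of `X_{1 - 1/q, q}` is the `L^q(0, ∞)`-norm of the average `K(t, f) / t`. -/
theorem interpNorm_eq (X : BanachPair 𝕜 V X₀ X₁) {q : ℝ} (hq : 1 < q) (f : V) :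
    X.interpNorm (1 - 1 / q) (ENNReal.ofReal q) f =
      (∫⁻ t in Ioi 0, X.avg t f ^ q) ^ (1 / q) := by
  have hq0 : 0 < q := by linarith
  rw [interpNorm, eLpNorm_eq_lintegral_rpow_enorm_toReal (by simpa using hq0)
    ENNReal.ofReal_ne_top, ENNReal.toReal_ofReal hq0.le, lintegral_dtOverT]
  congr 1
  refine setLIntegral_congr_fun measurableSet_Ioi fun t (ht : 0 < t) => ?_
  simp only [enorm_eq_self]
  rw [← X.ofReal_mul_avg ht f, ← mul_assoc, ← ENNReal.ofReal_mul (by positivity),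
    ENNReal.mul_rpow_of_nonneg _ _ hq0.le, ← mul_assoc,
    ENNReal.ofReal_rpow_of_nonneg (by positivity) hq0.le, ← ENNReal.ofReal_mul (by positivity)]
  have : t⁻¹ * (t ^ (-(1 - 1 / q)) * t) ^ q = 1 := by
    rw [← Real.rpow_add_one ht.ne', ← Real.rpow_mul ht.le, ← Real.rpow_neg_one,
      ← Real.rpow_add ht]
    have : -1 + (-(1 - 1 / q) + 1) * q = 0 := by field_simp; ring
    rw [this, Real.rpow_zero]
  rw [this]
  simp

theorem interpNorm_add_le (X : BanachPair 𝕜 V X₀ X₁) {q : ℝ} (hq : 1 < q) (f g : V) :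
    X.interpNorm (1 - 1 / q) (ENNReal.ofReal q) (f + g) ≤
      X.interpNorm (1 - 1 / q) (ENNReal.ofReal q) f +
        X.interpNorm (1 - 1 / q) (ENNReal.ofReal q) g := by
  simp only [X.interpNorm_eq hq]
  refine le_trans ?_ (ENNReal.lintegral_Lp_add_le (X.measurable_avg f).aemeasurable
    (X.measurable_avg g).aemeasurable hq.le)
  gcongr with t
  exact X.avg_add_le t f g

theorem interpNorm_smul_le (X : BanachPair 𝕜 V X₀ X₁) (θ : ℝ) (q : ℝ≥0∞) (c : 𝕜) (f : V) :
    X.interpNorm θ q (c • f) ≤ ‖c‖ₑ * X.interpNorm θ q f := by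
  refine eLpNorm_le_mul_eLpNorm_of_ae_le_mul' (c := ‖c‖₊)
    (Filter.Eventually.of_forall fun t => ?_) q
  simp only [enorm_eq_self]
  rw [mul_left_comm]
  gcongr
  exact X.K_smul_le t c f

/-- The average is non-increasing, so on (0, t] it is at least its value at t, and that interval
alone contributes t · avg(t)^q to the integral. -/
theorem rpow_mul_avg_le (X : BanachPair 𝕜 V X₀ X₁) {q : ℝ} (hq : 1 < q) {t : ℝ} (ht : 0 < t)
    (f : V) : ENNReal.ofReal t ^ (1 / q) * X.avg t f ≤
      X.interpNorm (1 - 1 / q) (ENNReal.ofReal q) f := by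
  have hq0 : 0 < q := by linarith
  rw [X.interpNorm_eq hq, one_div, ENNReal.le_rpow_inv_iff hq0,
    ENNReal.mul_rpow_of_nonneg _ _ hq0.le, ← ENNReal.rpow_mul, inv_mul_cancel₀ hq0.ne',
    ENNReal.rpow_one]
  calc ENNReal.ofReal t * X.avg t f ^ q = ∫⁻ _ in Ioc 0 t, X.avg t f ^ q := by
        simp [mul_comm]
    _ ≤ ∫⁻ s in Ioc 0 t, X.avg s f ^ q := by
        refine setLIntegral_mono ((X.measurable_avg f).pow_const q) fun s hs => ?_
        gcongr
        exact X.avg_antitoneOn f hs.1 ht hs.2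
    _ ≤ _ := lintegral_mono_set fun s hs => hs.1

theorem K_le_interpNorm (X : BanachPair 𝕜 V X₀ X₁) {q : ℝ} (hq : 1 < q) {t : ℝ} (ht : 0 < t)
    (f : V) : X.K t f ≤ ENNReal.ofReal (t ^ (1 - 1 / q)) *
      X.interpNorm (1 - 1 / q) (ENNReal.ofReal q) f := by
  refine le_trans (le_of_eq ?_) (mul_le_mul_right (X.rpow_mul_avg_le hq ht f) _)
  rw [← mul_assoc, ENNReal.ofReal_rpow_of_pos ht, ← ENNReal.ofReal_mul (by positivity),
    ← Real.rpow_add ht, sub_add_cancel, Real.rpow_one, X.ofReal_mul_avg ht]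

theorem K_one_le_interpNorm (X : BanachPair 𝕜 V X₀ X₁) {q : ℝ} (hq : 1 < q) (f : V) :
    X.K 1 f ≤ X.interpNorm (1 - 1 / q) (ENNReal.ofReal q) f := by
  simpa using X.K_le_interpNorm hq one_pos f

/-- Finiteness at t = 1 produces a decomposition, and one decomposition makes K finite at every t.
-/
theorem K_ne_top_of_interpNorm (X : BanachPair 𝕜 V X₀ X₁) {q : ℝ} (hq : 1 < q) {f : V}
    (hf : X.interpNorm (1 - 1 / q) (ENNReal.ofReal q) f < ∞) (t : ℝ) : X.K t f ≠ ∞ :=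
  X.K_ne_top_iff.2 (X.K_ne_top_iff.1 ((X.K_one_le_interpNorm hq f).trans_lt hf).ne)

end InterpolationNorm

end BanachPair

/-! ### Gain of integrability from a bounded dyadic drop -/

theorem ENNReal.exists_rpow_two_mul_le_of_le_add {p : ℝ} (hp : 0 < p) :
    ∃ C : ℝ≥0, ∀ a b c : ℝ≥0∞, a ≤ b + c → a ≠ ∞ →
      a ^ (2 * p) ≤ ENNReal.ofReal (3 / 2) * b ^ (2 * p) + C * c ^ p * a ^ p := by
  -- The threshold makes l^{2p} = 2/3. If b ≥ l a, then a^{2p} ≤ (3/2) b^{2p}; otherwise (1 - l) a ≤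
  -- c, and one factor a^p of a^{2p} is replaced by a multiple of c^p. Any constant below 2 instead
  -- of 3/2 would serve the later absorption.
  set l : ℝ := (2 / 3 : ℝ) ^ (1 / (2 * p)) with hl
  have hl0 : 0 < l := by positivity
  have hl1 : l < 1 := Real.rpow_lt_one (by norm_num) (by norm_num) (by positivity)
  have hl2 : l ^ (2 * p) = 2 / 3 := by
    rw [hl, ← Real.rpow_mul (by norm_num), one_div_mul_cancel (by positivity), Real.rpow_one]
  refine ⟨Real.toNNReal ((1 - l)⁻¹ ^ p), fun a b c h ha => ?_⟩
  have h2p : (0 : ℝ) ≤ 2 * p := by positivity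
  rcases le_or_gt (ENNReal.ofReal l * a) b with hb | hb
  · refine le_trans ?_ le_self_add
    calc a ^ (2 * p)
        = ENNReal.ofReal (3 / 2) * (ENNReal.ofReal l * a) ^ (2 * p) := by
          rw [ENNReal.mul_rpow_of_nonneg _ _ h2p, ENNReal.ofReal_rpow_of_pos hl0, hl2,
            ← mul_assoc, ← ENNReal.ofReal_mul (by norm_num)]
          norm_num
      _ ≤ _ := by gcongr
  · refine le_trans ?_ le_add_self
    have hc : a ≤ ENNReal.ofReal (1 - l)⁻¹ * c := by
      have h1 : ENNReal.ofReal (1 - l) * a ≤ c := by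
        have h2 : ENNReal.ofReal l * a + ENNReal.ofReal (1 - l) * a ≤ ENNReal.ofReal l * a + c := by
          rw [← add_mul, ← ENNReal.ofReal_add hl0.le (by linarith)]
          simpa using h.trans (by gcongr)
        exact (ENNReal.add_le_add_iff_left (ENNReal.mul_ne_top ENNReal.ofReal_ne_top ha)).1 h2
      calc a = ENNReal.ofReal (1 - l)⁻¹ * (ENNReal.ofReal (1 - l) * a) := by
            rw [← mul_assoc, ← ENNReal.ofReal_mul (by rw [inv_nonneg]; linarith),
              inv_mul_cancel₀ (by linarith)]
            simp
        _ ≤ _ := by gcongr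
    calc a ^ (2 * p) = a ^ p * a ^ p := by
          rw [two_mul, ENNReal.rpow_add_of_nonneg _ _ hp.le hp.le]
      _ ≤ (ENNReal.ofReal (1 - l)⁻¹ * c) ^ p * a ^ p := by gcongr
      _ = _ := by
          rw [ENNReal.mul_rpow_of_nonneg _ _ hp.le,
            ENNReal.ofReal_rpow_of_nonneg (by rw [inv_nonneg]; linarith) hp.le]
          rfl

/-- A function that drops by at most `c` when its argument doubles has better integrability: its
`L^{2p}`-norm is controlled by the geometric mean of `c` and its `L^p`-norm. -/
theorem exists_lintegral_rpow_two_mul_le {p : ℝ} (hp : 0 < p) :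
    ∃ C : ℝ≥0, ∀ (F : ℝ → ℝ≥0∞) (c : ℝ≥0∞), Measurable F →
      (∀ t, 0 < t → F t ≤ F (2 * t) + c) → ∫⁻ t in Ioi 0, F t ^ p ≠ ∞ →
      ∫⁻ t in Ioi 0, F t ^ (2 * p) ≤ C * c ^ p * ∫⁻ t in Ioi 0, F t ^ p := by
  obtain ⟨C, hC⟩ := ENNReal.exists_rpow_two_mul_le_of_le_add hp
  refine ⟨4 * C, fun F c hF hFc hfin => ?_⟩
  have h2p : (0 : ℝ) < 2 * p := by positivity
  -- Absorbing a multiple of the integral into the left side requires it to be finite. Truncation at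
  -- n ensures this, as min(F, n)^{2p} ≤ n^p F^p, and preserves the drop condition.
  have htr : ∀ n : ℕ, ∫⁻ t in Ioi 0, (min (F t) n) ^ (2 * p) ≤
      (4 * C : ℝ≥0) * c ^ p * ∫⁻ t in Ioi 0, F t ^ p := by
    intro n
    set A := ∫⁻ t in Ioi 0, (min (F t) n) ^ (2 * p) with hA
    have hAfin : A ≠ ∞ := by
      refine ((lintegral_mono fun t => ?_).trans_lt (b := ∫⁻ t in Ioi 0, (n : ℝ≥0∞) ^ p * F t ^ p)
        ?_).ne
      · rw [two_mul, ENNReal.rpow_add_of_nonneg _ _ hp.le hp.le]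
        gcongr
        · exact min_le_right _ _
        · exact min_le_left _ _
      · rw [lintegral_const_mul _ (hF.pow_const p)]
        exact ENNReal.mul_lt_top (ENNReal.rpow_lt_top_of_nonneg hp.le (by simp)) hfin.lt_top
    have hm : Measurable fun t => (min (F t) n) ^ (2 * p) := by fun_prop
    -- The factor 3/4 is 3/2 from the pointwise inequality times 1/2 from the substitution t ↦ 2t.
    have h1 : A ≤ ENNReal.ofReal (3 / 4) * A + C * c ^ p * ∫⁻ t in Ioi 0, F t ^ p := by
      calc A ≤ ∫⁻ t in Ioi 0, (ENNReal.ofReal (3 / 2) * (min (F (2 * t)) n) ^ (2 * p) +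
            C * c ^ p * F t ^ p) := by
            refine setLIntegral_mono (by fun_prop) fun t ht => ?_
            refine (hC _ (min (F (2 * t)) n) c ?_ ?_).trans ?_
            · rcases le_total (F (2 * t)) n with h | h
              · rw [min_eq_left h]
                exact (min_le_left _ _).trans (hFc t ht)
              · rw [min_eq_right h]
                exact (min_le_right _ _).trans le_self_add
            · exact ne_top_of_le_ne_top (by simp) (min_le_right (F t) (n : ℝ≥0∞))
            · gcongr
              exact min_le_left _ _
        _ = ENNReal.ofReal (3 / 2) * (ENNReal.ofReal 2⁻¹ * A) +
            C * c ^ p * ∫⁻ t in Ioi 0, F t ^ p := by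
            rw [lintegral_add_right _ (by fun_prop), lintegral_const_mul _ (by fun_prop),
              lintegral_const_mul _ (by fun_prop),
              setLIntegral_Ioi_comp_mul_left two_pos (fun t => (min (F t) n) ^ (2 * p))]
        _ = _ := by
            rw [← mul_assoc, ← ENNReal.ofReal_mul (by norm_num)]
            norm_num
    have h2 : ENNReal.ofReal (1 / 4) * A ≤ C * c ^ p * ∫⁻ t in Ioi 0, F t ^ p := by
      have h3 : ENNReal.ofReal (3 / 4) * A + ENNReal.ofReal (1 / 4) * A ≤
          ENNReal.ofReal (3 / 4) * A + C * c ^ p * ∫⁻ t in Ioi 0, F t ^ p := by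
        rw [← add_mul, ← ENNReal.ofReal_add (by norm_num) (by norm_num)]
        norm_num at h1 ⊢
        exact h1
      exact (ENNReal.add_le_add_iff_left (ENNReal.mul_ne_top ENNReal.ofReal_ne_top hAfin)).1 h3
    calc A = 4 * (ENNReal.ofReal (1 / 4) * A) := by
          rw [← mul_assoc, ← ENNReal.ofReal_ofNat 4, ← ENNReal.ofReal_mul (by norm_num)]
          norm_num
      _ ≤ 4 * (C * c ^ p * ∫⁻ t in Ioi 0, F t ^ p) := by gcongr
      _ = _ := by push_cast; ring
  have hsup : ∀ t, F t ^ (2 * p) = ⨆ n : ℕ, (min (F t) n) ^ (2 * p) := by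
    intro t
    have h1 := (ENNReal.orderIsoRpow (2 * p) h2p).map_iSup (fun n : ℕ => min (F t) n)
    simp only [ENNReal.orderIsoRpow_apply] at h1
    rw [← h1, ← inf_iSup_eq, ENNReal.iSup_natCast, inf_top_eq]
  simp only [hsup]
  rw [lintegral_iSup (fun n => by fun_prop)]
  · exact iSup_le htr
  · intro n m hnm t
    dsimp only
    gcongr

/-- The norm form of `exists_lintegral_rpow_two_mul_le`. -/
theorem exists_lintegral_Lp_two_mul_le {p : ℝ} (hp : 0 < p) :
    ∃ C : ℝ≥0, ∀ (F : ℝ → ℝ≥0∞) (c : ℝ≥0∞), Measurable F →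
      (∀ t, 0 < t → F t ≤ F (2 * t) + c) → ∫⁻ t in Ioi 0, F t ^ p ≠ ∞ →
      (∫⁻ t in Ioi 0, F t ^ (2 * p)) ^ (1 / (2 * p)) ≤
        C * ((∫⁻ t in Ioi 0, F t ^ p) ^ (1 / p)) ^ (1 / 2 : ℝ) * c ^ (1 / 2 : ℝ) := by
  obtain ⟨C, hC⟩ := exists_lintegral_rpow_two_mul_le hp
  refine ⟨C ^ (1 / (2 * p)), fun F c hF hFc hfin => ?_⟩
  refine (ENNReal.rpow_le_rpow (hC F c hF hFc hfin) (by positivity)).trans (le_of_eq ?_)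
  rw [ENNReal.mul_rpow_of_nonneg _ _ (by positivity),
    ENNReal.mul_rpow_of_nonneg _ _ (by positivity),
    ← ENNReal.rpow_mul, ← ENNReal.rpow_mul, ENNReal.coe_rpow_of_nonneg _ (by positivity),
    show p * (1 / (2 * p)) = 1 / 2 by field_simp, show 1 / p * (1 / 2) = 1 / (2 * p) by field_simp]
  ring

/-! ### From the Gagliardo norm to a bound on the dyadic drop -/

/-- If `k` is monotone, `k s / s` is antitone and `k s / s - k' s ≤ γ` almost everywhere, then
`k s / s` decreases by at most `γ` from `t` to `2 t`. -/
theorem sub_le_of_ae_sub_deriv_le {k : ℝ → ℝ} {γ t : ℝ} (ht : 0 < t) (hγ0 : 0 ≤ γ)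
    (hk0 : ∀ s, 0 < s → 0 ≤ k s)
    (hk : MonotoneOn k (Ioi 0)) (hφ : AntitoneOn (fun s => k s / s) (Ioi 0))
    (hγ : ∀ᵐ s ∂(volume.restrict (Ioi (0 : ℝ))), k s / s - deriv k s ≤ γ) :
    k t / t ≤ k (2 * t) / (2 * t) + γ := by
  have htt : t ≤ 2 * t := by linarith
  set φ : ℝ → ℝ := fun s => k s / s with hφdef
  -- An almost everywhere derivative bound can be integrated only for an absolutely continuous
  -- function. Monotonicity of k limits the descent of k s / s, so no appeal to concavity is needed.
  have hlip : LipschitzOnWith (Real.toNNReal (k (2 * t) / t ^ 2)) φ (uIcc t (2 * t)) := by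
    rw [uIcc_of_le htt]
    refine LipschitzOnWith.of_le_add_mul _ fun x hx y hy => ?_
    have hx0 : 0 < x := ht.trans_le hx.1
    have hy0 : 0 < y := ht.trans_le hy.1
    have hK : 0 ≤ k (2 * t) / t ^ 2 := div_nonneg (hk0 _ (by linarith)) (by positivity)
    rw [Real.coe_toNNReal _ hK]
    rcases le_total y x with h | h
    · have h1 : φ x ≤ φ y := hφ hy0 hx0 h
      have := mul_nonneg hK (dist_nonneg (x := x) (y := y))
      linarith
    · have h1 : k x ≤ k y := hk hx0 hy0 h
      have h2 : k x ≤ k (2 * t) := hk hx0 (by show (0 : ℝ) < 2 * t; linarith) hx.2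
      have h3 : φ x - φ y ≤ k x / x - k x / y := by
        simp only [hφdef]
        gcongr
      have h4 : k x / x - k x / y = k x * (y - x) / (x * y) := by field_simp
      have h5 : k x * (y - x) / (x * y) ≤ k (2 * t) * (y - x) / t ^ 2 := by
        have : t ^ 2 ≤ x * y := by nlinarith [hx.1, hy.1]
        have := hk0 x hx0
        have : 0 ≤ y - x := by linarith
        have := mul_nonneg (hk0 (2 * t) (by linarith)) this
        gcongr
      rw [Real.dist_eq, abs_sub_comm, abs_of_nonneg (by linarith)]
      have h6 : k (2 * t) / t ^ 2 * (y - x) = k (2 * t) * (y - x) / t ^ 2 := by ring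
      linarith
  have hac := hlip.absolutelyContinuousOnInterval
  have hint := hac.integral_deriv_eq_sub
  have hdiff := hac.boundedVariationOn.ae_differentiableAt_of_mem_uIcc
  -- Here φ' = -(k/s - k')/s ≥ -γ/s, and 1/s is replaced by 1/t on [t, 2t]; this costs only the
  -- passage from log 2 to 1.
  have hb : ∫ s in t..2 * t, -(γ / t) ≤ ∫ s in t..2 * t, deriv φ s := by
    refine intervalIntegral.integral_mono_ae_restrict htt (by simp) hac.intervalIntegrable_deriv ?_
    have hγ' : ∀ᵐ s ∂(volume.restrict (Icc t (2 * t))), k s / s - deriv k s ≤ γ :=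
      ae_restrict_of_ae_restrict_of_subset (fun s hs => ht.trans_le hs.1) hγ
    rw [uIcc_of_le htt] at hdiff
    filter_upwards [hγ', ae_restrict_of_ae hdiff, ae_restrict_mem measurableSet_Icc]
      with s hs hd hmem
    have hs0 : 0 < s := ht.trans_le hmem.1
    have hd' := (hd hmem).hasDerivAt
    have hkd : HasDerivAt k (φ s + s * deriv φ s) s := by
      have h1 := (hasDerivAt_id s).mul hd'
      simp only [id, one_mul] at h1
      refine h1.congr_of_eventuallyEq ?_
      filter_upwards [lt_mem_nhds hs0] with r hr
      simp only [hφdef, Pi.mul_apply, id]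
      field_simp
    rw [hkd.deriv] at hs
    have h2 : -γ ≤ s * deriv φ s := by simp only [hφdef] at hs ⊢; linarith
    calc -(γ / t) ≤ -(γ / s) := by
          have := hmem.1
          gcongr
      _ = -γ / s := (neg_div _ _).symm
      _ ≤ deriv φ s := by rwa [div_le_iff₀ hs0, mul_comm]
  rw [hint] at hb
  simp only [intervalIntegral.integral_const, smul_eq_mul] at hb
  have : (2 * t - t) * -(γ / t) = -γ := by field_simp; ring
  simp only [hφdef] at hb
  linarith

namespace BanachPair

section Gagliardo

variable {𝕜 V X₀ X₁ : Type*} [RCLike 𝕜]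
  [AddCommGroup V] [Module 𝕜 V] [TopologicalSpace V]
  [NormedAddCommGroup X₀] [NormedSpace 𝕜 X₀]
  [NormedAddCommGroup X₁] [NormedSpace 𝕜 X₁]

theorem avg_eq_ofReal (X : BanachPair 𝕜 V X₀ X₁) {t : ℝ} (ht : 0 < t) {f : V}
    (h : X.K t f ≠ ∞) : X.avg t f = ENNReal.ofReal ((X.K t f).toReal / t) := by
  rw [avg, ENNReal.ofReal_div_of_pos ht, ENNReal.ofReal_toReal h]

theorem avg_le_avg_two_mul_add (X : BanachPair 𝕜 V X₀ X₁) {f : V} (hf : ∀ t, X.K t f ≠ ∞)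
    {t : ℝ} (ht : 0 < t) : X.avg t f ≤ X.avg (2 * t) f + X.gagliardoNorm₁ 1 ∞ f := by
  by_cases hγ : X.gagliardoNorm₁ 1 ∞ f = ∞
  · simp [hγ]
  have h2t : 0 < 2 * t := by linarith
  have hae := ae_dtOverT (enorm_ae_le_eLpNormEssSup (fun s : ℝ => s ^ (1 - 1 : ℝ) *
    ((X.K s f).toReal / s - deriv (fun r : ℝ => (X.K r f).toReal) s)) dtOverT)
  rw [← eLpNorm_exponent_top] at hae
  change ∀ᵐ s ∂_, _ ≤ X.gagliardoNorm₁ 1 ∞ f at hae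
  have key := sub_le_of_ae_sub_deriv_le (k := fun s => (X.K s f).toReal)
    (γ := (X.gagliardoNorm₁ 1 ∞ f).toReal) ht ENNReal.toReal_nonneg
    (fun _ _ => ENNReal.toReal_nonneg)
    (fun s _ r _ hsr => ENNReal.toReal_mono (hf r) (X.K_mono f hsr))
    (fun s hs r hr hsr => ?_) ?_
  · rw [X.avg_eq_ofReal ht (hf t), X.avg_eq_ofReal h2t (hf _), ← ENNReal.ofReal_toReal hγ,
      ← ENNReal.ofReal_add (by positivity) ENNReal.toReal_nonneg]
    exact ENNReal.ofReal_le_ofReal key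
  · have h := X.avg_antitoneOn f hs hr hsr
    have hs' : 0 < s := hs
    dsimp only at h
    rwa [X.avg_eq_ofReal hr (hf r), X.avg_eq_ofReal hs (hf s),
      ENNReal.ofReal_le_ofReal_iff (by positivity)] at h
  · filter_upwards [hae] with s hs
    simp only [sub_self, Real.rpow_zero, one_mul] at hs
    rw [← ofReal_norm, ENNReal.ofReal_le_iff_le_toReal hγ] at hs
    exact (le_abs_self _).trans hs

/-- Interpolation between `X_{1 - 1/p, p}` and the first Gagliardo coordinate space. -/
theorem exists_interpNorm_le_gagliardoNorm {p : ℝ} (hp : 1 < p) :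
    ∃ C : ℝ≥0, ∀ (𝕜 V X₀ X₁ : Type*) [RCLike 𝕜]
      [AddCommGroup V] [Module 𝕜 V] [TopologicalSpace V]
      [NormedAddCommGroup X₀] [NormedSpace 𝕜 X₀]
      [NormedAddCommGroup X₁] [NormedSpace 𝕜 X₁]
      (X : BanachPair 𝕜 V X₀ X₁) (f : V),
      f ∈ X.interpSpace (1 - 1 / p) (ENNReal.ofReal p) →
      X.interpNorm (1 - 1 / (2 * p)) (ENNReal.ofReal (2 * p)) f ≤
        C * X.interpNorm (1 - 1 / p) (ENNReal.ofReal p) f ^ (1 / 2 : ℝ) *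
          X.gagliardoNorm₁ 1 ∞ f ^ (1 / 2 : ℝ) := by
  have hp0 : 0 < p := by linarith
  obtain ⟨C, hC⟩ := exists_lintegral_Lp_two_mul_le hp0
  refine ⟨C, ?_⟩
  intro 𝕜 V X₀ X₁ _ _ _ _ _ _ _ _ X f hf
  have hf' : X.interpNorm (1 - 1 / p) (ENNReal.ofReal p) f < ∞ := hf
  rw [X.interpNorm_eq hp, X.interpNorm_eq (by linarith)]
  refine hC _ _ (X.measurable_avg f)
    (fun t ht => X.avg_le_avg_two_mul_add (X.K_ne_top_of_interpNorm hp hf') ht) ?_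
  rw [X.interpNorm_eq hp, ENNReal.rpow_lt_top_iff_of_pos (by positivity)] at hf'
  exact hf'.ne

end Gagliardo

end BanachPair

/-! ### Cauchy–Schwarz and a dyadic Hardy inequality -/

/-- The Cauchy–Schwarz inequality `‖F G‖_p ≤ ‖F‖_{2p} ‖G‖_{2p}`. -/
theorem lintegral_Lp_mul_le {α : Type*} [MeasurableSpace α] {μ : Measure α} {p : ℝ} (hp : 0 < p)
    {F G : α → ℝ≥0∞} (hF : AEMeasurable F μ) (hG : AEMeasurable G μ) :
    (∫⁻ x, (F x * G x) ^ p ∂μ) ^ (1 / p) ≤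
      (∫⁻ x, F x ^ (2 * p) ∂μ) ^ (1 / (2 * p)) * (∫⁻ x, G x ^ (2 * p) ∂μ) ^ (1 / (2 * p)) := by
  have h := ENNReal.lintegral_mul_le_Lp_mul_Lq μ Real.HolderConjugate.two_two
    (hF.pow_const p) (hG.pow_const p)
  have h' := ENNReal.rpow_le_rpow h (show 0 ≤ 1 / p by positivity)
  rw [ENNReal.mul_rpow_of_nonneg _ _ (by positivity)] at h'
  simp only [← ENNReal.rpow_mul, Pi.mul_apply, mul_comm p 2] at h'
  simp only [ENNReal.mul_rpow_of_nonneg _ _ hp.le]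
  rwa [show 1 / 2 * (1 / p) = 1 / (2 * p) by field_simp] at h'

/-- A dyadic form of Hardy's inequality. -/
theorem exists_hardy_dyadic {p : ℝ} (hp : 1 < p) :
    ∃ C : ℝ≥0, ∀ H : ℝ → ℝ≥0∞, Measurable H →
      (∫⁻ t in Ioi 0, (∑' n : ℕ, ENNReal.ofReal (2⁻¹ ^ n) * H (2⁻¹ ^ n * t)) ^ p) ^ (1 / p) ≤
        C * (∫⁻ t in Ioi 0, H t ^ p) ^ (1 / p) := by
  have hp0 : 0 < p := by linarith
  -- Composition with the dilation by 2^{-n} multiplies the L^p norm by 2^{n/p}; together with the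
  -- weight 2^{-n} this is r^n, and r < 1 because p > 1.
  set r : ℝ := (2⁻¹ : ℝ) ^ (1 - 1 / p) with hr
  have hr0 : 0 < r := by positivity
  have hr1 : r < 1 := by
    refine Real.rpow_lt_one (by norm_num) (by norm_num) ?_
    rw [sub_pos, div_lt_one hp0]
    exact hp
  refine ⟨Real.toNNReal (1 - r)⁻¹, fun H hH => ?_⟩
  refine (lintegral_Lp_tsum_le hp.le (fun n => by fun_prop)).trans ?_
  have hterm : ∀ n : ℕ, (∫⁻ t in Ioi 0, (ENNReal.ofReal (2⁻¹ ^ n) * H (2⁻¹ ^ n * t)) ^ p) ^ (1 / p)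
      = ENNReal.ofReal r ^ n * (∫⁻ t in Ioi 0, H t ^ p) ^ (1 / p) := by
    intro n
    have hn : (0 : ℝ) < 2⁻¹ ^ n := by positivity
    simp only [ENNReal.mul_rpow_of_nonneg _ _ hp0.le]
    rw [lintegral_const_mul _ (by fun_prop),
      setLIntegral_Ioi_comp_mul_left hn (fun t => H t ^ p), ← mul_assoc,
      ENNReal.mul_rpow_of_nonneg _ _ (by positivity),
      ENNReal.ofReal_rpow_of_pos hn, ← ENNReal.ofReal_mul (by positivity),
      ENNReal.ofReal_rpow_of_pos (by positivity), ← ENNReal.ofReal_pow hr0.le]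
    congr 2
    rw [← Real.rpow_neg_one ((2⁻¹ : ℝ) ^ n), ← Real.rpow_add hn, ← Real.rpow_mul hn.le, hr,
      ← Real.rpow_natCast, ← Real.rpow_natCast, ← Real.rpow_mul (by norm_num),
      ← Real.rpow_mul (by norm_num)]
    congr 1
    field_simp
    ring
  simp only [hterm]
  rw [ENNReal.tsum_mul_right, ENNReal.tsum_geometric, ← ENNReal.ofReal_one,
    ← ENNReal.ofReal_sub _ hr0.le, ← ENNReal.ofReal_inv_of_pos (by linarith)]
  rfl

/-! ### The product on X₁ × X₁: telescoping over dyadic scales -/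

namespace BanachPair.ProductOperator

variable {𝕜 V X₀ X₁ : Type*} [RCLike 𝕜]
  [AddCommGroup V] [Module 𝕜 V] [TopologicalSpace V]
  [NormedAddCommGroup X₀] [NormedSpace 𝕜 X₀]
  [NormedAddCommGroup X₁] [NormedSpace 𝕜 X₁] {X : BanachPair 𝕜 V X₀ X₁}

theorem enorm_m₁₁_le (P : X.ProductOperator) (a b : X₁) :
    ‖P.m₁₁ a b‖ₑ ≤ P.bound * ‖a‖ₑ * ‖b‖ₑ := by
  simp only [enorm_eq_nnnorm]
  norm_cast
  have h : ‖P.m₁₁ a b‖₊ ≤ ‖P.m₁₁‖₊ * ‖a‖₊ * ‖b‖₊ := P.m₁₁.le_opNorm₂ a b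
  have h' : ‖P.m₁₁‖₊ ≤ P.bound := le_max_left _ _
  exact h.trans (by gcongr)

theorem enorm_m₁₀_le (P : X.ProductOperator) (a : X₁) (b : X₀) :
    ‖P.m₁₀ a b‖ₑ ≤ P.bound * ‖a‖ₑ * ‖b‖ₑ := by
  simp only [enorm_eq_nnnorm]
  norm_cast
  have h : ‖P.m₁₀ a b‖₊ ≤ ‖P.m₁₀‖₊ * ‖a‖₊ * ‖b‖₊ := P.m₁₀.le_opNorm₂ a b
  have h' : ‖P.m₁₀‖₊ ≤ P.bound := (le_max_left _ _).trans (le_max_right _ _)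
  exact h.trans (by gcongr)

theorem enorm_m₀₁_le (P : X.ProductOperator) (a : X₀) (b : X₁) :
    ‖P.m₀₁ a b‖ₑ ≤ P.bound * ‖a‖ₑ * ‖b‖ₑ := by
  simp only [enorm_eq_nnnorm]
  norm_cast
  have h : ‖P.m₀₁ a b‖₊ ≤ ‖P.m₀₁‖₊ * ‖a‖₊ * ‖b‖₊ := P.m₀₁.le_opNorm₂ a b
  have h' : ‖P.m₀₁‖₊ ≤ P.bound := (le_max_right _ _).trans (le_max_right _ _)
  exact h.trans (by gcongr)

theorem m₁₀_eq_m₀₁ (P : X.ProductOperator) {a b : X₁} {a' b' : X₀} (ha : X.i₁ a = X.i₀ a')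
    (hb : X.i₁ b = X.i₀ b') : P.m₁₀ a b' = P.m₀₁ a' b :=
  X.inj₀ ((P.compat_right a b b' hb).symm.trans (P.compat_left a b a' ha))

/-- As a and a₁ lie in X₁, the part a₀ is also the element a - a₁ of X₁. This gives a meaning to
Π(a₀, b₀), a product of two X₀-parts on which the operator is otherwise not defined. -/
theorem i₁_m₁₁_eq (P : X.ProductOperator) {a b a₁ b₁ : X₁} {a₀ b₀ : X₀}
    (ha : X.i₀ a₀ + X.i₁ a₁ = X.i₁ a) (hb : X.i₀ b₀ + X.i₁ b₁ = X.i₁ b) :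
    X.i₁ (P.m₁₁ a b) =
      X.i₀ (P.m₁₀ (a - a₁) b₀ + P.m₀₁ a₀ b₁ + P.m₁₀ a₁ b₀) + X.i₁ (P.m₁₁ a₁ b₁) := by
  have ha' : X.i₁ (a - a₁) = X.i₀ a₀ := by rw [map_sub, ← ha, add_sub_cancel_right]
  have hb' : X.i₁ (b - b₁) = X.i₀ b₀ := by rw [map_sub, ← hb, add_sub_cancel_right]
  rw [map_add, map_add, ← P.compat_right _ _ _ hb', ← P.compat_left _ _ _ ha',
    ← P.compat_right _ _ _ hb', ← map_add, ← map_add, ← map_add]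
  congr 1
  simp only [map_sub, sub_apply]
  abel

/-- One telescoping step: the change of `Π(a - a₁, b - b₁)` in `X₀` when the decompositions of `a`
and `b` are changed. -/
theorem enorm_m₁₀_sub_le (P : X.ProductOperator) {a b a₁ b₁ c₁ d₁ : X₁} {b₀ c₀ d₀ : X₀}
    (hb : X.i₀ b₀ + X.i₁ b₁ = X.i₁ b)
    (hc : X.i₀ c₀ + X.i₁ c₁ = X.i₁ a) (hd : X.i₀ d₀ + X.i₁ d₁ = X.i₁ b) :
    ‖P.m₁₀ (a - a₁) b₀‖ₑ ≤ ‖P.m₁₀ (a - c₁) d₀‖ₑ +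
      (P.bound * ‖c₁ - a₁‖ₑ * ‖b₀‖ₑ + P.bound * ‖c₀‖ₑ * ‖d₁ - b₁‖ₑ) := by
  have hc' : X.i₁ (a - c₁) = X.i₀ c₀ := by rw [map_sub, ← hc, add_sub_cancel_right]
  have hbd : X.i₁ (d₁ - b₁) = X.i₀ (b₀ - d₀) := by
    rw [map_sub, map_sub, sub_eq_sub_iff_add_eq_add, hb, add_comm, hd]
  -- Only one factor is changed at a time. The differences c₁ - a₁ and b₀ - d₀ = d₁ - b₁ lie in X₁,
  -- so each error term pairs an element of X₁ with one of X₀.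
  have h : P.m₁₀ (a - a₁) b₀ = P.m₁₀ (a - c₁) d₀ +
      (P.m₁₀ (c₁ - a₁) b₀ + P.m₀₁ c₀ (d₁ - b₁)) := by
    rw [← P.m₁₀_eq_m₀₁ hc' hbd]
    simp only [map_sub, sub_apply]
    abel
  rw [h]
  refine (enorm_add_le _ _).trans ?_
  gcongr
  refine (enorm_add_le _ _).trans ?_
  gcongr
  · exact P.enorm_m₁₀_le _ _
  · exact P.enorm_m₀₁_le _ _

variable [IsTopologicalAddGroup V] [T2Space V]

/-- The pointwise estimate of the `K`-functional of a product. -/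
theorem avg_m₁₁_le (P : X.ProductOperator) (a b : X₁) {t : ℝ} (ht : 0 < t) :
    X.avg t (X.i₁ (P.m₁₁ a b)) ≤ 24 * P.bound * ∑' n : ℕ, ENNReal.ofReal (2⁻¹ ^ n) *
      (X.avg (2⁻¹ ^ n * t) (X.i₁ a) * X.avg (2⁻¹ ^ n * t) (X.i₁ b)) := by
  set M : ℝ≥0∞ := (P.bound : ℝ≥0∞)
  set s : ℕ → ℝ := fun n => 2⁻¹ ^ n * t with hs
  have hs0 : ∀ n, 0 < s n := fun n => by positivity
  have hss : ∀ n, s n = 2 * s (n + 1) := fun n => by simp only [hs, pow_succ]; ring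
  have hle : ∀ n, s (n + 1) ≤ s n := fun n => by linarith [hss n, hs0 (n + 1)]
  have hK : ∀ (c : X₁) (r : ℝ), X.K r (X.i₁ c) ≠ ∞ := fun c r =>
    X.K_ne_top_iff.2 ⟨0, c, by simp⟩
  choose a₀ a₁ ha ha₀ ha₁ using fun n => X.exists_decomposition_avg (hs0 n) (hK a (s n))
  choose b₀ b₁ hb hb₀ hb₁ using fun n => X.exists_decomposition_avg (hs0 n) (hK b (s n))
  set F : ℕ → ℝ≥0∞ := fun n => X.avg (s n) (X.i₁ a) with hF
  set G : ℕ → ℝ≥0∞ := fun n => X.avg (s n) (X.i₁ b) with hG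
  simp only [← X.ofReal_mul_avg (hs0 _)] at ha₀ hb₀
  change ∀ n, ‖a₀ n‖ₑ ≤ 2 * (ENNReal.ofReal (s n) * F n) at ha₀
  change ∀ n, ‖b₀ n‖ₑ ≤ 2 * (ENNReal.ofReal (s n) * G n) at hb₀
  change ∀ n, ‖a₁ n‖ₑ ≤ 2 * F n at ha₁
  change ∀ n, ‖b₁ n‖ₑ ≤ 2 * G n at hb₁
  have hFm : ∀ n, F n ≤ F (n + 1) := fun n => X.avg_antitoneOn _ (hs0 _) (hs0 _) (hle n)
  have hGm : ∀ n, G n ≤ G (n + 1) := fun n => X.avg_antitoneOn _ (hs0 _) (hs0 _) (hle n)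
  have hFa : ∀ n, F n ≤ ‖a‖ₑ := fun n => X.avg_i₁_le _ _
  have hGb : ∀ n, G n ≤ ‖b‖ₑ := fun n => X.avg_i₁_le _ _
  set ψ : ℕ → ℝ≥0∞ := fun n => ENNReal.ofReal (s n) * (F n * G n) with hψ
  -- Passing to half the scale changes each X₁-part by at most 4F or 4G. The two error terms have
  -- coefficients 4 · 4 and 2 · 4, whence 24.
  have hstep : ∀ n, ‖P.m₁₀ (a - a₁ n) (b₀ n)‖ₑ ≤
      ‖P.m₁₀ (a - a₁ (n + 1)) (b₀ (n + 1))‖ₑ + 24 * M * ψ (n + 1) := by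
    intro n
    refine (P.enorm_m₁₀_sub_le (hb n) (ha (n + 1)) (hb (n + 1))).trans ?_
    gcongr
    have e1 : ‖a₁ (n + 1) - a₁ n‖ₑ ≤ 4 * F (n + 1) :=
      calc ‖a₁ (n + 1) - a₁ n‖ₑ ≤ ‖a₁ (n + 1)‖ₑ + ‖a₁ n‖ₑ := enorm_sub_le
        _ ≤ 2 * F (n + 1) + 2 * F (n + 1) := by
          gcongr
          · exact ha₁ _
          · exact (ha₁ n).trans (by gcongr; exact hFm n)
        _ = _ := by ring
    have e2 : ‖b₁ (n + 1) - b₁ n‖ₑ ≤ 4 * G (n + 1) :=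
      calc ‖b₁ (n + 1) - b₁ n‖ₑ ≤ ‖b₁ (n + 1)‖ₑ + ‖b₁ n‖ₑ := enorm_sub_le
        _ ≤ 2 * G (n + 1) + 2 * G (n + 1) := by
          gcongr
          · exact hb₁ _
          · exact (hb₁ n).trans (by gcongr; exact hGm n)
        _ = _ := by ring
    have e3 : ‖b₀ n‖ₑ ≤ 4 * (ENNReal.ofReal (s (n + 1)) * G (n + 1)) := by
      refine (hb₀ n).trans ?_
      rw [hss n, ENNReal.ofReal_mul (by norm_num), ENNReal.ofReal_ofNat]
      calc 2 * (2 * ENNReal.ofReal (s (n + 1)) * G n)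
          ≤ 2 * (2 * ENNReal.ofReal (s (n + 1)) * G (n + 1)) := by gcongr; exact hGm n
        _ = _ := by ring
    calc M * ‖a₁ (n + 1) - a₁ n‖ₑ * ‖b₀ n‖ₑ + M * ‖a₀ (n + 1)‖ₑ * ‖b₁ (n + 1) - b₁ n‖ₑ
        ≤ M * (4 * F (n + 1)) * (4 * (ENNReal.ofReal (s (n + 1)) * G (n + 1))) +
          M * (2 * (ENNReal.ofReal (s (n + 1)) * F (n + 1))) * (4 * G (n + 1)) := by
          gcongr
          exact ha₀ _
      _ = _ := by simp only [hψ]; ring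
  have hsum : ∀ N, ‖P.m₁₀ (a - a₁ 0) (b₀ 0)‖ₑ ≤
      24 * M * ∑ n ∈ Finset.range N, ψ (n + 1) + ‖P.m₁₀ (a - a₁ N) (b₀ N)‖ₑ := by
    intro N
    induction N with
    | zero => simp
    | succ N ih =>
      refine ih.trans ?_
      rw [Finset.sum_range_succ, mul_add, add_assoc]
      gcongr
      rw [add_comm]
      exact hstep N
  -- For elements of X₁ the averages stay below ‖a‖ and ‖b‖, so the remainder is O(s N) and
  -- disappears in the limit.
  have hrem : ∀ N, ‖P.m₁₀ (a - a₁ N) (b₀ N)‖ₑ ≤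
      6 * M * ‖a‖ₑ * ‖b‖ₑ * ENNReal.ofReal (s N) := by
    intro N
    calc ‖P.m₁₀ (a - a₁ N) (b₀ N)‖ₑ ≤ M * ‖a - a₁ N‖ₑ * ‖b₀ N‖ₑ := P.enorm_m₁₀_le _ _
      _ ≤ M * (‖a‖ₑ + 2 * ‖a‖ₑ) * (2 * (ENNReal.ofReal (s N) * ‖b‖ₑ)) := by
          gcongr
          · exact enorm_sub_le.trans (by gcongr; exact (ha₁ N).trans (by gcongr; exact hFa N))
          · exact (hb₀ N).trans (by gcongr; exact hGb N)
      _ = _ := by ring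
  have hlim : Filter.Tendsto (fun N => 24 * M * ∑' n, ψ (n + 1) +
      6 * M * ‖a‖ₑ * ‖b‖ₑ * ENNReal.ofReal (s N)) Filter.atTop
      (nhds (24 * M * ∑' n, ψ (n + 1) + 6 * M * ‖a‖ₑ * ‖b‖ₑ * ENNReal.ofReal 0)) := by
    refine Filter.Tendsto.const_add _ (ENNReal.Tendsto.const_mul ?_ (Or.inr ?_))
    · refine ENNReal.tendsto_ofReal ?_
      have := (tendsto_pow_atTop_nhds_zero_of_lt_one (r := (2⁻¹ : ℝ)) (by norm_num)
        (by norm_num)).mul_const t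
      rwa [zero_mul] at this
    · exact ENNReal.mul_ne_top (ENNReal.mul_ne_top (ENNReal.mul_ne_top (by simp) (by simp [M]))
        enorm_ne_top) enorm_ne_top
  simp only [ENNReal.ofReal_zero, mul_zero, add_zero] at hlim
  have hΦ : ‖P.m₁₀ (a - a₁ 0) (b₀ 0)‖ₑ ≤ 24 * M * ∑' n, ψ (n + 1) := by
    refine ge_of_tendsto' hlim fun N => (hsum N).trans ?_
    gcongr
    · exact ENNReal.sum_le_tsum _
    · exact hrem N
  have hst : s 0 = t := by simp [hs]
  have hKle : X.K t (X.i₁ (P.m₁₁ a b)) ≤ 24 * M * ∑' n, ψ n := by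
    refine (X.K_le t (P.i₁_m₁₁_eq (ha 0) (hb 0)).symm).trans ?_
    rw [tsum_eq_zero_add' ENNReal.summable, mul_add]
    calc ‖P.m₁₀ (a - a₁ 0) (b₀ 0) + P.m₀₁ (a₀ 0) (b₁ 0) + P.m₁₀ (a₁ 0) (b₀ 0)‖ₑ +
          ENNReal.ofReal t * ‖P.m₁₁ (a₁ 0) (b₁ 0)‖ₑ
        ≤ (‖P.m₁₀ (a - a₁ 0) (b₀ 0)‖ₑ + ‖P.m₀₁ (a₀ 0) (b₁ 0)‖ₑ + ‖P.m₁₀ (a₁ 0) (b₀ 0)‖ₑ) +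
          ENNReal.ofReal t * ‖P.m₁₁ (a₁ 0) (b₁ 0)‖ₑ := by
          gcongr
          exact (enorm_add_le _ _).trans (by gcongr; exact enorm_add_le _ _)
      _ ≤ (24 * M * ∑' n, ψ (n + 1) + M * (2 * (ENNReal.ofReal (s 0) * F 0)) * (2 * G 0) +
            M * (2 * F 0) * (2 * (ENNReal.ofReal (s 0) * G 0))) +
          ENNReal.ofReal (s 0) * (M * (2 * F 0) * (2 * G 0)) := by
          rw [hst]
          gcongr
          · refine (P.enorm_m₀₁_le _ _).trans ?_
            gcongr
            · simpa [hst] using ha₀ 0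
            · exact hb₁ 0
          · refine (P.enorm_m₁₀_le _ _).trans ?_
            gcongr
            · exact ha₁ 0
            · simpa [hst] using hb₀ 0
          · refine (P.enorm_m₁₁_le _ _).trans ?_
            gcongr
            · exact ha₁ 0
            · exact hb₁ 0
      -- The three products other than Π(a₀, b₀) contribute 4Mψ(0) each; 12 is enlarged to 24 to
      -- merge this with the series.
      _ = 12 * M * ψ 0 + 24 * M * ∑' n, ψ (n + 1) := by simp only [hψ]; ring
      _ ≤ _ := by gcongr; norm_num
  have ht0 : ENNReal.ofReal t ≠ 0 := by simpa using ht
  refine ENNReal.div_le_of_le_mul (hKle.trans_eq ?_)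
  rw [mul_assoc (24 * M), ← ENNReal.tsum_mul_right]
  congr 2
  funext n
  simp only [hψ, hs]
  rw [ENNReal.ofReal_mul (by positivity)]
  ring

/-- Boundedness of an operator of product type for the interpolation norms, on `X₁ × X₁`. -/
theorem exists_interpNorm_m₁₁_le {p : ℝ} (hp : 1 < p) :
    ∃ C : ℝ≥0, ∀ (𝕜 V X₀ X₁ : Type*) [RCLike 𝕜]
      [AddCommGroup V] [Module 𝕜 V] [TopologicalSpace V]
      [IsTopologicalAddGroup V] [T2Space V]
      [NormedAddCommGroup X₀] [NormedSpace 𝕜 X₀]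
      [NormedAddCommGroup X₁] [NormedSpace 𝕜 X₁]
      (X : BanachPair 𝕜 V X₀ X₁) (P : X.ProductOperator) (a b : X₁),
      X.interpNorm (1 - 1 / p) (ENNReal.ofReal p) (X.i₁ (P.m₁₁ a b)) ≤
        C * P.bound * X.interpNorm (1 - 1 / (2 * p)) (ENNReal.ofReal (2 * p)) (X.i₁ a) *
          X.interpNorm (1 - 1 / (2 * p)) (ENNReal.ofReal (2 * p)) (X.i₁ b) := by
  have hp0 : 0 < p := by linarith
  obtain ⟨C, hC⟩ := exists_hardy_dyadic hp
  refine ⟨24 * C, ?_⟩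
  intro 𝕜 V X₀ X₁ _ _ _ _ _ _ _ _ _ _ X P a b
  rw [X.interpNorm_eq hp, X.interpNorm_eq (by linarith), X.interpNorm_eq (by linarith)]
  set H : ℝ → ℝ≥0∞ := fun t => X.avg t (X.i₁ a) * X.avg t (X.i₁ b) with hH
  have hHm : Measurable H := (X.measurable_avg _).mul (X.measurable_avg _)
  calc (∫⁻ t in Ioi 0, X.avg t (X.i₁ (P.m₁₁ a b)) ^ p) ^ (1 / p)
      ≤ (∫⁻ t in Ioi 0, (24 * P.bound) ^ p *
          (∑' n : ℕ, ENNReal.ofReal (2⁻¹ ^ n) * H (2⁻¹ ^ n * t)) ^ p) ^ (1 / p) := by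
        refine ENNReal.rpow_le_rpow (setLIntegral_mono' measurableSet_Ioi fun t ht => ?_)
          (by positivity)
        rw [← ENNReal.mul_rpow_of_nonneg _ _ hp0.le]
        gcongr
        exact P.avg_m₁₁_le a b ht
    _ = 24 * P.bound * (∫⁻ t in Ioi 0,
          (∑' n : ℕ, ENNReal.ofReal (2⁻¹ ^ n) * H (2⁻¹ ^ n * t)) ^ p) ^ (1 / p) := by
        rw [lintegral_const_mul _ (by fun_prop), ENNReal.mul_rpow_of_nonneg _ _ (by positivity),
          ← ENNReal.rpow_mul, mul_one_div_cancel hp0.ne', ENNReal.rpow_one]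
    _ ≤ 24 * P.bound * (C * ((∫⁻ t in Ioi 0, X.avg t (X.i₁ a) ^ (2 * p)) ^ (1 / (2 * p)) *
          (∫⁻ t in Ioi 0, X.avg t (X.i₁ b) ^ (2 * p)) ^ (1 / (2 * p)))) := by
        gcongr
        refine (hC H hHm).trans ?_
        gcongr
        exact lintegral_Lp_mul_le hp0 (X.measurable_avg _).aemeasurable
          (X.measurable_avg _).aemeasurable
    _ = _ := by push_cast; ring

end BanachPair.ProductOperator

namespace BanachPair

/-! ### Completeness of the interpolation space and density of X₁ -/

section Completeness

variable {𝕜 V X₀ X₁ : Type*} [RCLike 𝕜]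
  [AddCommGroup V] [Module 𝕜 V] [TopologicalSpace V]
  [NormedAddCommGroup X₀] [NormedSpace 𝕜 X₀]
  [NormedAddCommGroup X₁] [NormedSpace 𝕜 X₁]
  [IsTopologicalAddGroup V] [T2Space V]

/-- Almost optimal decompositions of the terms form absolutely convergent series in X₀ and in X₁,
which may be summed separately; the factor 2 is the loss in near-optimality. -/
theorem exists_hasSum_K_le [CompleteSpace X₀] [CompleteSpace X₁] (X : BanachPair 𝕜 V X₀ X₁)
    {t : ℝ} (ht : 0 < t) {v : ℕ → V} (h : ∑' n, X.K t (v n) ≠ ∞) :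
    ∃ w, HasSum v w ∧ X.K t w ≤ 2 * ∑' n, X.K t (v n) := by
  choose x₀ x₁ hx hle using fun n =>
    X.exists_decomposition ht (ENNReal.ne_top_of_tsum_ne_top h n)
  have ht0 : ENNReal.ofReal t ≠ 0 := by simpa using ht
  have hsum : ∑' n, (‖x₀ n‖ₑ + ENNReal.ofReal t * ‖x₁ n‖ₑ) ≤ 2 * ∑' n, X.K t (v n) := by
    rw [← ENNReal.tsum_mul_left]
    exact ENNReal.tsum_le_tsum hle
  have hlt : ∑' n, (‖x₀ n‖ₑ + ENNReal.ofReal t * ‖x₁ n‖ₑ) < ∞ :=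
    hsum.trans_lt (ENNReal.mul_lt_top (by simp) h.lt_top)
  rw [ENNReal.tsum_add, ENNReal.tsum_mul_left] at hsum hlt
  obtain ⟨h0, h1⟩ := ENNReal.add_lt_top.1 hlt
  have h1 : ∑' n, ‖x₁ n‖ₑ < ∞ := by
    by_contra hcon
    rw [not_lt, top_le_iff] at hcon
    rw [hcon, ENNReal.mul_top ht0] at h1
    exact lt_irrefl _ h1
  have hs0 : Summable x₀ :=
    Summable.of_nnnorm (ENNReal.tsum_coe_ne_top_iff_summable.1
      (by simpa [enorm_eq_nnnorm] using h0.ne))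
  have hs1 : Summable x₁ :=
    Summable.of_nnnorm (ENNReal.tsum_coe_ne_top_iff_summable.1
      (by simpa [enorm_eq_nnnorm] using h1.ne))
  refine ⟨X.i₀ (∑' n, x₀ n) + X.i₁ (∑' n, x₁ n), ?_, (X.K_le t rfl).trans (le_trans ?_ hsum)⟩
  · simpa only [hx] using (hs0.hasSum.mapL X.i₀).add (hs1.hasSum.mapL X.i₁)
  · gcongr
    · exact enorm_tsum_le_tsum_enorm
    · exact enorm_tsum_le_tsum_enorm

theorem K_le_two_mul_tsum [CompleteSpace X₀] [CompleteSpace X₁] (X : BanachPair 𝕜 V X₀ X₁)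
    {t : ℝ} (ht : 0 < t) {v : ℕ → V} {w : V} (hw : HasSum v w) :
    X.K t w ≤ 2 * ∑' n, X.K t (v n) := by
  by_cases h : ∑' n, X.K t (v n) = ∞
  · simp [h]
  · obtain ⟨w', hw', hle⟩ := X.exists_hasSum_K_le ht h
    rwa [hw.unique hw']

theorem interpNorm_le_two_mul_tsum [CompleteSpace X₀] [CompleteSpace X₁]
    (X : BanachPair 𝕜 V X₀ X₁) {q : ℝ} (hq : 1 < q) {v : ℕ → V} {w : V} (hw : HasSum v w) :
    X.interpNorm (1 - 1 / q) (ENNReal.ofReal q) w ≤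
      2 * ∑' n, X.interpNorm (1 - 1 / q) (ENNReal.ofReal q) (v n) := by
  have hq0 : 0 < q := by linarith
  simp only [X.interpNorm_eq hq]
  refine le_trans ?_ (mul_le_mul_right (lintegral_Lp_tsum_le (μ := volume.restrict (Ioi 0)) hq.le
    (φ := fun n t => X.avg t (v n)) (fun n => X.measurable_avg (v n))) 2)
  calc (∫⁻ t in Ioi 0, X.avg t w ^ q) ^ (1 / q)
      ≤ (∫⁻ t in Ioi 0, 2 ^ q * (∑' n, X.avg t (v n)) ^ q) ^ (1 / q) := by
        refine ENNReal.rpow_le_rpow (setLIntegral_mono' measurableSet_Ioi fun t ht => ?_)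
          (by positivity)
        rw [← ENNReal.mul_rpow_of_nonneg _ _ hq0.le]
        gcongr
        simp only [avg, div_eq_mul_inv]
        rw [ENNReal.tsum_mul_right, ← mul_assoc]
        gcongr
        exact X.K_le_two_mul_tsum ht hw
    _ = _ := by
        rw [lintegral_const_mul _ ((Measurable.tsum fun n => X.measurable_avg _).pow_const q),
          ENNReal.mul_rpow_of_nonneg _ _ (by positivity), ← ENNReal.rpow_mul,
          mul_one_div_cancel hq0.ne', ENNReal.rpow_one]

/-- Completeness of `X_{1 - 1/q, q}`: absolutely convergent series converge. -/
theorem exists_interpNorm_sub_le_tsum [CompleteSpace X₀] [CompleteSpace X₁]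
    (X : BanachPair 𝕜 V X₀ X₁) {q : ℝ} (hq : 1 < q) {v : ℕ → V}
    (hv : ∑' n, X.interpNorm (1 - 1 / q) (ENNReal.ofReal q) (v n) ≠ ∞) :
    ∃ w, ∀ n, X.interpNorm (1 - 1 / q) (ENNReal.ofReal q) (w - ∑ i ∈ Finset.range n, v i) ≤
      2 * ∑' i, X.interpNorm (1 - 1 / q) (ENNReal.ofReal q) (v (i + n)) := by
  obtain ⟨w, hw, -⟩ := X.exists_hasSum_K_le one_pos (v := v)
    (ne_top_of_le_ne_top hv (ENNReal.tsum_le_tsum fun n => X.K_one_le_interpNorm hq (v n)))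
  refine ⟨w, fun n => X.interpNorm_le_two_mul_tsum hq ?_⟩
  exact (hasSum_nat_add_iff' n).2 hw

/-- Density of `X₁` in `X_{1 - 1/q, q}`. -/
theorem exists_interpNorm_sub_i₁_lt (X : BanachPair 𝕜 V X₀ X₁) {q : ℝ} (hq : 1 < q) {f : V}
    (hf : X.interpNorm (1 - 1 / q) (ENNReal.ofReal q) f < ∞) {ε : ℝ≥0∞} (hε : 0 < ε) :
    ∃ x₁, X.interpNorm (1 - 1 / q) (ENNReal.ofReal q) (f - X.i₁ x₁) < ε := by
  have hq0 : 0 < q := by linarith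
  set t : ℕ → ℝ := fun n => 1 / ((n : ℝ) + 1) with ht
  have ht0 : ∀ n, 0 < t n := fun n => by positivity
  choose x₀ x₁ hx h₀ h₁ using fun n =>
    X.exists_decomposition_avg (ht0 n) (X.K_ne_top_of_interpNorm hq hf (t n))
  have hsub : ∀ n, f - X.i₁ (x₁ n) = X.i₀ (x₀ n) := fun n => by
    rw [← hx n, add_sub_cancel_right]
  have hKx : ∀ n s, X.K s (f - X.i₁ (x₁ n)) ≤ 2 * X.K (t n) f := fun n s => by
    rw [hsub]
    exact (X.K_i₀_le s _).trans (h₀ n)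
  -- This is the majorant for dominated convergence. Below t n the X₁-part is bounded by twice the
  -- average of f; above it the X₀-part is bounded by 2K(t n, f) ≤ 2K(s, f). Pointwise convergence
  -- follows from K(t n, f) → 0.
  have hbound : ∀ n s, 0 < s → X.avg s (f - X.i₁ (x₁ n)) ≤ 3 * X.avg s f := by
    intro n s hs
    rcases le_total s (t n) with h | h
    · rw [sub_eq_add_neg, ← map_neg]
      calc X.avg s (f + X.i₁ (-x₁ n)) ≤ X.avg s f + ‖-x₁ n‖ₑ :=
            (X.avg_add_le _ _ _).trans (by gcongr; exact X.avg_i₁_le _ _)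
        _ ≤ X.avg s f + 2 * X.avg s f := by
            rw [enorm_neg]
            gcongr
            exact (h₁ n).trans (by gcongr; exact X.avg_antitoneOn f hs (ht0 n) h)
        _ = _ := by ring
    · calc X.avg s (f - X.i₁ (x₁ n)) ≤ 2 * X.K s f / ENNReal.ofReal s := by
            rw [avg]
            gcongr
            exact (hKx n s).trans (by gcongr; exact X.K_mono f h)
        _ = 2 * X.avg s f := mul_div_assoc _ _ _
        _ ≤ _ := by gcongr; norm_num
  have hfin : ∫⁻ s in Ioi 0, X.avg s f ^ q < ∞ := by
    rwa [X.interpNorm_eq hq, ENNReal.rpow_lt_top_iff_of_pos (by positivity)] at hf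
  have hK0 : Filter.Tendsto (fun n => X.K (t n) f) Filter.atTop (nhds 0) := by
    have h1 : Filter.Tendsto (fun n => ENNReal.ofReal (t n ^ (1 - 1 / q)) *
        X.interpNorm (1 - 1 / q) (ENNReal.ofReal q) f) Filter.atTop
        (nhds (ENNReal.ofReal (0 ^ (1 - 1 / q)) *
          X.interpNorm (1 - 1 / q) (ENNReal.ofReal q) f)) := by
      refine ENNReal.Tendsto.mul_const (ENNReal.tendsto_ofReal ?_) (Or.inr hf.ne)
      refine (tendsto_one_div_add_atTop_nhds_zero_nat (𝕜 := ℝ)).rpow_const (Or.inr ?_)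
      rw [sub_nonneg, div_le_one hq0]
      exact hq.le
    have h2 : 1 - 1 / q ≠ 0 := (sub_pos.2 ((div_lt_one hq0).2 hq)).ne'
    rw [Real.zero_rpow h2, ENNReal.ofReal_zero, zero_mul] at h1
    exact tendsto_of_tendsto_of_tendsto_of_le_of_le tendsto_const_nhds h1 (fun _ => zero_le)
      (fun n => X.K_le_interpNorm hq (ht0 n) f)
  have hlim : Filter.Tendsto (fun n => ∫⁻ s in Ioi 0, X.avg s (f - X.i₁ (x₁ n)) ^ q)
      Filter.atTop (nhds (∫⁻ _ in Ioi (0 : ℝ), 0)) := by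
    refine tendsto_lintegral_of_dominated_convergence (fun s => (3 * X.avg s f) ^ q)
      (fun n => (X.measurable_avg _).pow_const q) (fun n => ?_) ?_ ?_
    · filter_upwards [ae_restrict_mem measurableSet_Ioi] with s hs
      gcongr
      exact hbound n s hs
    · simp only [ENNReal.mul_rpow_of_nonneg _ _ hq0.le]
      rw [lintegral_const_mul _ ((X.measurable_avg f).pow_const q)]
      exact ENNReal.mul_ne_top (by simp) hfin.ne
    · filter_upwards [ae_restrict_mem measurableSet_Ioi] with s hs
      have hs0 : ENNReal.ofReal s ≠ 0 := by simpa using hs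
      have h1 : Filter.Tendsto (fun n => 2 * X.K (t n) f / ENNReal.ofReal s) Filter.atTop
          (nhds (2 * 0 / ENNReal.ofReal s)) :=
        ENNReal.Tendsto.div_const (ENNReal.Tendsto.const_mul hK0 (by simp)) (Or.inr hs0)
      rw [mul_zero, ENNReal.zero_div] at h1
      have h2 : Filter.Tendsto (fun n => X.avg s (f - X.i₁ (x₁ n))) Filter.atTop (nhds 0) :=
        tendsto_of_tendsto_of_tendsto_of_le_of_le tendsto_const_nhds h1 (fun _ => zero_le)
          (fun n => by
            dsimp only [avg]
            gcongr
            exact hKx n s)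
      have h3 := h2.ennrpow_const q
      rwa [ENNReal.zero_rpow_of_pos hq0] at h3
  have hlim' := hlim.ennrpow_const (1 / q)
  rw [lintegral_zero, ENNReal.zero_rpow_of_pos (by positivity)] at hlim'
  obtain ⟨n, hn⟩ := (hlim'.eventually_lt_const hε).exists
  exact ⟨x₁ n, by rwa [X.interpNorm_eq hq]⟩

end Completeness

end BanachPair

/-! ### Extension of bounded bilinear maps from a dense subspace -/

section BilinearExtension

variable {𝕜 Y Z : Type*} [RCLike 𝕜] [AddCommGroup Y] [Module 𝕜 Y] [AddCommGroup Z] [Module 𝕜 Z]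

/-- The normed group associated with a separating seminorm. -/
@[reducible] def Seminorm.toNormedAddCommGroupOfSeparating (n : Seminorm 𝕜 Y)
    (h : ∀ y, n y = 0 → y = 0) : NormedAddCommGroup Y :=
  AddGroupNorm.toNormedAddCommGroup { n.toAddGroupSeminorm with eq_zero_of_map_eq_zero' := h }

/-- A bounded bilinear map on a dense subspace, with values in a complete space, extends. -/
theorem exists_bilinear_extension_of_normed {Y Z : Type*} [NormedAddCommGroup Y]
    [NormedSpace 𝕜 Y] [NormedAddCommGroup Z] [NormedSpace 𝕜 Z] [CompleteSpace Z]
    {D : Submodule 𝕜 Y} (hD : DenseRange ((↑) : D → Y)) (B : D →ₗ[𝕜] D →ₗ[𝕜] Z) {C : ℝ}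
    (hB : ∀ d e, ‖B d e‖ ≤ C * ‖d‖ * ‖e‖) :
    ∃ T : Y →ₗ[𝕜] Y →ₗ[𝕜] Z, (∀ d e : D, T d e = B d e) ∧ ∀ x y, ‖T x y‖ ≤ C * ‖x‖ * ‖y‖ := by
  have hu : IsUniformInducing (D.subtypeL : D → Y) :=
    isUniformEmbedding_subtype_val.isUniformInducing
  have hD' : DenseRange (D.subtypeL : D → Y) := hD
  set B' : D →L[𝕜] D →L[𝕜] Z := B.mkContinuous₂ C hB
  set T₁ : Y →L[𝕜] D →L[𝕜] Z := B'.extend D.subtypeL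
  -- The variables are extended one at a time, with a flip in between.
  set T : Y →L[𝕜] Y →L[𝕜] Z := (T₁.flip.extend D.subtypeL).flip
  have hT : ∀ d e : D, T d e = B d e := by
    intro d e
    have h1 : T₁.flip.extend D.subtypeL (D.subtypeL e) = T₁.flip e :=
      ContinuousLinearMap.extend_eq _ hD' hu e
    have h2 : B'.extend D.subtypeL (D.subtypeL d) = B' d :=
      ContinuousLinearMap.extend_eq _ hD' hu d
    calc T d e = T₁.flip.extend D.subtypeL (D.subtypeL e) (d : Y) := rfl
      _ = B'.extend D.subtypeL (D.subtypeL d) e := by rw [h1]; rfl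
      _ = B d e := by rw [h2]; rfl
  refine ⟨T.toLinearMap₁₂, hT, fun x y => ?_⟩
  refine hD.induction_on₂ (p := fun x y => ‖T x y‖ ≤ C * ‖x‖ * ‖y‖) ?_ ?_ x y
  · exact isClosed_le (by fun_prop) (by fun_prop)
  · intro d e
    rw [hT]
    exact hB d e

/-- Bounded bilinear maps that agree on a dense subspace are equal. -/
theorem bilinear_ext_of_normed {Y Z : Type*} [NormedAddCommGroup Y]
    [NormedSpace 𝕜 Y] [NormedAddCommGroup Z] [NormedSpace 𝕜 Z]
    {D : Submodule 𝕜 Y} (hD : DenseRange ((↑) : D → Y)) {S T : Y →ₗ[𝕜] Y →ₗ[𝕜] Z} {B C : ℝ}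
    (hS : ∀ x y, ‖S x y‖ ≤ B * ‖x‖ * ‖y‖) (hT : ∀ x y, ‖T x y‖ ≤ C * ‖x‖ * ‖y‖)
    (h : ∀ d e : D, S d e = T d e) : S = T := by
  ext x y
  refine hD.induction_on₂ (p := fun x y => S.mkContinuous₂ B hS x y = T.mkContinuous₂ C hT x y)
    ?_ h x y
  exact isClosed_eq (by fun_prop) (by fun_prop)

/-- The formulation by seminorms serves the interpolation spaces, which are bare subspaces of `V`:
the norm structures are introduced only inside the proof. -/
theorem Seminorm.exists_bilinear_extension (nY : Seminorm 𝕜 Y) (nZ : Seminorm 𝕜 Z)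
    (hY : ∀ y, nY y = 0 → y = 0) (hZ : ∀ z, nZ z = 0 → z = 0)
    (hcomplete : ∀ u : ℕ → Z, Summable (fun n => nZ (u n)) →
      ∃ z, Filter.Tendsto (fun n => nZ (∑ i ∈ Finset.range n, u i - z)) Filter.atTop (nhds 0))
    {D : Submodule 𝕜 Y} (hD : ∀ y, ∀ ε > 0, ∃ d ∈ D, nY (y - d) < ε)
    (B : D →ₗ[𝕜] D →ₗ[𝕜] Z) {C : ℝ} (hB : ∀ d e : D, nZ (B d e) ≤ C * nY d * nY e) :
    ∃ T : Y →ₗ[𝕜] Y →ₗ[𝕜] Z, (∀ d e : D, T d e = B d e) ∧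
      (∀ x y, nZ (T x y) ≤ C * nY x * nY y) ∧
      ∀ (S : Y →ₗ[𝕜] Y →ₗ[𝕜] Z) (C' : ℝ), (∀ x y, nZ (S x y) ≤ C' * nY x * nY y) →
        (∀ d e : D, S d e = B d e) → S = T := by
  let _ := nY.toNormedAddCommGroupOfSeparating hY
  let _ := nZ.toNormedAddCommGroupOfSeparating hZ
  let _ : NormedSpace 𝕜 Y := ⟨fun c y => (map_smul_eq_mul nY c y).le⟩
  let _ : NormedSpace 𝕜 Z := ⟨fun c z => (map_smul_eq_mul nZ c z).le⟩
  have hZc : CompleteSpace Z := by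
    refine NormedAddCommGroup.completeSpace_of_summable_imp_tendsto fun u hu => ?_
    obtain ⟨z, hz⟩ := hcomplete u hu
    exact ⟨z, tendsto_iff_norm_sub_tendsto_zero.2 hz⟩
  have hDd : DenseRange ((↑) : D → Y) := by
    intro y
    rw [Metric.mem_closure_range_iff]
    intro ε hε
    obtain ⟨d, hd, hlt⟩ := hD y ε hε
    exact ⟨⟨d, hd⟩, by rw [dist_eq_norm]; exact hlt⟩
  obtain ⟨T, hT, hTle⟩ := exists_bilinear_extension_of_normed hDd B hB
  exact ⟨T, hT, hTle, fun S C' hS hSB =>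
    bilinear_ext_of_normed hDd hS hTle fun d e => (hSB d e).trans (hT d e).symm⟩

end BilinearExtension

/-- The product of two geometric means, estimated by an arithmetic mean. -/
theorem ENNReal.geometric_mul_le {x y a b c d : ℝ≥0∞} {C : ℝ≥0}
    (hx : x ≤ C * a ^ (1 / 2 : ℝ) * c ^ (1 / 2 : ℝ))
    (hy : y ≤ C * b ^ (1 / 2 : ℝ) * d ^ (1 / 2 : ℝ)) :
    x * y ≤ C ^ 2 * (a * d + b * c) := by
  have hsq : ∀ z : ℝ≥0∞, z ^ (1 / 2 : ℝ) * z ^ (1 / 2 : ℝ) = z := fun z => by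
    rw [← ENNReal.rpow_add_of_nonneg _ _ (by norm_num) (by norm_num)]
    norm_num
  calc x * y ≤ (C * a ^ (1 / 2 : ℝ) * c ^ (1 / 2 : ℝ)) * (C * b ^ (1 / 2 : ℝ) * d ^ (1 / 2 : ℝ)) :=
        by gcongr
    _ = C ^ 2 * ((a * d) ^ (1 / 2 : ℝ) * (b * c) ^ (1 / 2 : ℝ)) := by
        rw [ENNReal.mul_rpow_of_nonneg _ _ (by norm_num),
          ENNReal.mul_rpow_of_nonneg _ _ (by norm_num)]
        ring
    -- Both ad and bc are at most their sum, which suffices up to a constant.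
    _ ≤ C ^ 2 * ((a * d + b * c) ^ (1 / 2 : ℝ) * (a * d + b * c) ^ (1 / 2 : ℝ)) := by
        gcongr
        · exact le_self_add
        · exact le_add_self
    _ = _ := by rw [hsq]

namespace BanachPair

/-! ### The interpolation space as a separated, complete seminormed space -/

section InterpolationSpace

variable {𝕜 V X₀ X₁ : Type*} [RCLike 𝕜]
  [AddCommGroup V] [Module 𝕜 V] [TopologicalSpace V]
  [NormedAddCommGroup X₀] [NormedSpace 𝕜 X₀]
  [NormedAddCommGroup X₁] [NormedSpace 𝕜 X₁]

/-- The norm of `X_{1 - 1/q, q}` as a seminorm. -/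
noncomputable def interpSeminorm (X : BanachPair 𝕜 V X₀ X₁) {q : ℝ} (hq : 1 < q) :
    Seminorm 𝕜 (X.interpSpace (1 - 1 / q) (ENNReal.ofReal q)) :=
  Seminorm.ofSMulLE (fun f => (X.interpNorm (1 - 1 / q) (ENNReal.ofReal q) f).toReal)
    (by
      have h := X.interpNorm_smul_le (1 - 1 / q) (ENNReal.ofReal q) (0 : 𝕜) 0
      rw [enorm_zero, zero_mul, zero_smul, nonpos_iff_eq_zero] at h
      simp only [h, ENNReal.toReal_zero, ZeroMemClass.coe_zero])
    (fun f g => by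
      have hf : X.interpNorm (1 - 1 / q) (ENNReal.ofReal q) f < ∞ := f.2
      have hg : X.interpNorm (1 - 1 / q) (ENNReal.ofReal q) g < ∞ := g.2
      rw [← ENNReal.toReal_add hf.ne hg.ne]
      exact ENNReal.toReal_mono (ENNReal.add_ne_top.2 ⟨hf.ne, hg.ne⟩)
        (X.interpNorm_add_le hq f g))
    (fun c f => by
      have hf : X.interpNorm (1 - 1 / q) (ENNReal.ofReal q) f < ∞ := f.2
      rw [← toReal_enorm c, ← ENNReal.toReal_mul]
      exact ENNReal.toReal_mono (ENNReal.mul_ne_top enorm_ne_top hf.ne)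
        (X.interpNorm_smul_le _ _ c f))

theorem ofReal_interpSeminorm (X : BanachPair 𝕜 V X₀ X₁) {q : ℝ} (hq : 1 < q)
    (f : X.interpSpace (1 - 1 / q) (ENNReal.ofReal q)) :
    ENNReal.ofReal (X.interpSeminorm hq f) = X.interpNorm (1 - 1 / q) (ENNReal.ofReal q) f := by
  have hf : X.interpNorm (1 - 1 / q) (ENNReal.ofReal q) f < ∞ := f.2
  exact ENNReal.ofReal_toReal hf.ne

/-- The elements of `X₁` in the space `X_{1 - 1/q, q}`. -/
def interpSpaceInter (X : BanachPair 𝕜 V X₀ X₁) (θ : ℝ) (q : ℝ≥0∞) :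
    Submodule 𝕜 (X.interpSpace θ q) :=
  (LinearMap.range X.i₁.toLinearMap).comap (X.interpSpace θ q).subtype

variable [IsTopologicalAddGroup V] [T2Space V]

theorem eq_zero_of_interpSeminorm_eq_zero (X : BanachPair 𝕜 V X₀ X₁) {q : ℝ} (hq : 1 < q)
    (f : X.interpSpace (1 - 1 / q) (ENNReal.ofReal q)) (h : X.interpSeminorm hq f = 0) :
    f = 0 := by
  have h0 : X.interpNorm (1 - 1 / q) (ENNReal.ofReal q) f = 0 := by
    rw [← X.ofReal_interpSeminorm hq, h, ENNReal.ofReal_zero]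
  have h1 := X.K_one_le_interpNorm hq (f : V)
  rw [h0, nonpos_iff_eq_zero] at h1
  exact Subtype.ext (X.eq_zero_of_K_eq_zero one_pos h1)

theorem interpSpaceInter_dense (X : BanachPair 𝕜 V X₀ X₁) {q : ℝ} (hq : 1 < q)
    (f : X.interpSpace (1 - 1 / q) (ENNReal.ofReal q)) {ε : ℝ} (hε : 0 < ε) :
    ∃ d ∈ X.interpSpaceInter (1 - 1 / q) (ENNReal.ofReal q), X.interpSeminorm hq (f - d) < ε := by
  obtain ⟨x₁, hx⟩ := X.exists_interpNorm_sub_i₁_lt hq f.2 (ENNReal.ofReal_pos.2 hε)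
  have hmem : f - X.i₁ x₁ ∈ X.interpSpace (1 - 1 / q) (ENNReal.ofReal q) :=
    hx.trans ENNReal.ofReal_lt_top
  have hmem' : X.i₁ x₁ ∈ X.interpSpace (1 - 1 / q) (ENNReal.ofReal q) := by
    have := Submodule.sub_mem _ f.2 hmem
    rwa [sub_sub_cancel] at this
  refine ⟨⟨X.i₁ x₁, hmem'⟩, ⟨x₁, rfl⟩, ?_⟩
  rw [← ENNReal.ofReal_lt_ofReal_iff hε, X.ofReal_interpSeminorm hq]
  exact hx

theorem interpSpace_complete [CompleteSpace X₀] [CompleteSpace X₁] (X : BanachPair 𝕜 V X₀ X₁)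
    {q : ℝ} (hq : 1 < q) (u : ℕ → X.interpSpace (1 - 1 / q) (ENNReal.ofReal q))
    (hu : Summable fun n => X.interpSeminorm hq (u n)) :
    ∃ z, Filter.Tendsto (fun n => X.interpSeminorm hq (∑ i ∈ Finset.range n, u i - z))
      Filter.atTop (nhds 0) := by
  have hsum : ∑' n, X.interpNorm (1 - 1 / q) (ENNReal.ofReal q) (u n : V) ≠ ∞ := by
    simp only [← X.ofReal_interpSeminorm hq]
    exact hu.tsum_ofReal_ne_top
  obtain ⟨w, hw⟩ := X.exists_interpNorm_sub_le_tsum hq hsum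
  have hwmem : w ∈ X.interpSpace (1 - 1 / q) (ENNReal.ofReal q) := by
    have h0 := hw 0
    simp only [Finset.range_zero, Finset.sum_empty, sub_zero, add_zero] at h0
    exact h0.trans_lt (ENNReal.mul_lt_top (by simp) hsum.lt_top)
  refine ⟨⟨w, hwmem⟩, ?_⟩
  have hlim := ENNReal.Tendsto.const_mul (a := 2) (ENNReal.tendsto_sum_nat_add _ hsum)
    (Or.inr (by simp))
  rw [mul_zero] at hlim
  have hlim' : Filter.Tendsto (fun n => ENNReal.ofReal
      (X.interpSeminorm hq (∑ i ∈ Finset.range n, u i - ⟨w, hwmem⟩))) Filter.atTop (nhds 0) := by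
    refine tendsto_of_tendsto_of_tendsto_of_le_of_le tendsto_const_nhds hlim (fun _ => zero_le)
      (fun n => ?_)
    dsimp only
    rw [map_sub_rev, X.ofReal_interpSeminorm hq]
    simpa using hw n
  have h2 := (ENNReal.tendsto_toReal ENNReal.zero_ne_top).comp hlim'
  refine h2.congr fun n => ?_
  exact ENNReal.toReal_ofReal (apply_nonneg _ _)

end InterpolationSpace

/-! ### The bounded extension of an operator of product type -/

namespace ProductOperator

variable {𝕜 V X₀ X₁ : Type*} [RCLike 𝕜]
  [AddCommGroup V] [Module 𝕜 V] [TopologicalSpace V]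
  [NormedAddCommGroup X₀] [NormedSpace 𝕜 X₀]
  [NormedAddCommGroup X₁] [NormedSpace 𝕜 X₁] {X : BanachPair 𝕜 V X₀ X₁}

/-- The operator with exchanged arguments. -/
noncomputable def swap (P : X.ProductOperator) : X.ProductOperator where
  m₁₁ := P.m₁₁.flip
  m₁₀ := P.m₀₁.flip
  m₀₁ := P.m₁₀.flip
  compat_right a b b' h := P.compat_left b a b' h
  compat_left a b a' h := P.compat_right b a a' h

/-- The product of an element of `X₁` and an element of `X₀ + X₁` does not depend on the
decomposition of the latter. -/
theorem right_well_defined (P : X.ProductOperator) (a : X₁) {b₀ c₀ : X₀} {b₁ c₁ : X₁}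
    (h : X.i₀ b₀ + X.i₁ b₁ = X.i₀ c₀ + X.i₁ c₁) :
    X.i₀ (P.m₁₀ a b₀) + X.i₁ (P.m₁₁ a b₁) = X.i₀ (P.m₁₀ a c₀) + X.i₁ (P.m₁₁ a c₁) := by
  have h1 : X.i₁ (b₁ - c₁) = X.i₀ (c₀ - b₀) := by
    rw [map_sub, map_sub, sub_eq_sub_iff_add_eq_add, ← h, add_comm]
  have h2 := P.compat_right a _ _ h1
  rw [map_sub, map_sub, map_sub, map_sub, sub_eq_sub_iff_add_eq_add] at h2
  rw [← h2, add_comm]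

variable [IsTopologicalAddGroup V] [T2Space V]

/-- Multiplication by a fixed a in X₁ is bounded on X₀ and on X₁. Independence of the decomposition
allows passing to an almost optimal one, at the price of the factor 2. -/
theorem K_right_le (P : X.ProductOperator) {t : ℝ} (ht : 0 < t) (a : X₁) (b₀ : X₀) (b₁ : X₁) :
    X.K t (X.i₀ (P.m₁₀ a b₀) + X.i₁ (P.m₁₁ a b₁)) ≤
      2 * P.bound * ‖a‖ₑ * X.K t (X.i₀ b₀ + X.i₁ b₁) := by
  obtain ⟨c₀, c₁, hc, hle⟩ := X.exists_decomposition ht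
    (X.K_ne_top_iff (t := t).2 ⟨b₀, b₁, rfl⟩)
  rw [P.right_well_defined a hc.symm]
  calc _ ≤ ‖P.m₁₀ a c₀‖ₑ + ENNReal.ofReal t * ‖P.m₁₁ a c₁‖ₑ := X.K_le t rfl
    _ ≤ P.bound * ‖a‖ₑ * ‖c₀‖ₑ + ENNReal.ofReal t * (P.bound * ‖a‖ₑ * ‖c₁‖ₑ) := by
        gcongr
        · exact P.enorm_m₁₀_le _ _
        · exact P.enorm_m₁₁_le _ _
    _ = P.bound * ‖a‖ₑ * (‖c₀‖ₑ + ENNReal.ofReal t * ‖c₁‖ₑ) := by ring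
    _ ≤ P.bound * ‖a‖ₑ * (2 * X.K t (X.i₀ b₀ + X.i₁ b₁)) := by gcongr
    _ = _ := by ring

/-- A bounded bilinear map that agrees with the product on `X₁ × X₁` agrees with it on
`X₁ × (X₀ + X₁)`. -/
theorem extension_right (P : X.ProductOperator) {p q : ℝ} (hp : 1 < p) (hq : 1 < q)
    {T : X.interpSpace (1 - 1 / q) (ENNReal.ofReal q) →ₗ[𝕜]
      X.interpSpace (1 - 1 / q) (ENNReal.ofReal q) →ₗ[𝕜]
      X.interpSpace (1 - 1 / p) (ENNReal.ofReal p)} {C : ℝ≥0}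
    (hT : ∀ f g, X.interpNorm (1 - 1 / p) (ENNReal.ofReal p) (T f g) ≤
      C * X.interpNorm (1 - 1 / q) (ENNReal.ofReal q) f *
        X.interpNorm (1 - 1 / q) (ENNReal.ofReal q) g)
    (hT₁ : ∀ (f g : X.interpSpace (1 - 1 / q) (ENNReal.ofReal q)) (a b : X₁),
      (f : V) = X.i₁ a → (g : V) = X.i₁ b → (T f g : V) = X.i₁ (P.m₁₁ a b))
    (f g : X.interpSpace (1 - 1 / q) (ENNReal.ofReal q)) (a : X₁) (b₀ : X₀) (b₁ : X₁)
    (hf : (f : V) = X.i₁ a) (hg : (g : V) = X.i₀ b₀ + X.i₁ b₁) :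
    (T f g : V) = X.i₀ (P.m₁₀ a b₀) + X.i₁ (P.m₁₁ a b₁) := by
  have hf' : X.interpNorm (1 - 1 / q) (ENNReal.ofReal q) f < ∞ := f.2
  set c : ℝ≥0∞ := C * X.interpNorm (1 - 1 / q) (ENNReal.ofReal q) f + 2 * P.bound * ‖a‖ₑ with hc
  have hctop : c ≠ ∞ := by
    refine ENNReal.add_ne_top.2 ⟨ENNReal.mul_ne_top ENNReal.coe_ne_top hf'.ne, ?_⟩
    exact ENNReal.mul_ne_top (ENNReal.mul_ne_top (by simp) (by simp)) enorm_ne_top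
  -- With g replaced by a nearby e from X₁ both sides agree by `hT₁`. The error g - e is controlled
  -- in K(1, ·) by the bound for T on one side and by `K_right_le` on the other; the two constants
  -- add up to c.
  have key : ∀ ε : ℝ, 0 < ε →
      X.K 1 (T f g - (X.i₀ (P.m₁₀ a b₀) + X.i₁ (P.m₁₁ a b₁))) ≤ c * ENNReal.ofReal ε := by
    intro ε hε
    obtain ⟨e, ⟨x, hx⟩, hlt⟩ := X.interpSpaceInter_dense hq g hε
    change X.i₁ x = (e : V) at hx
    rw [← ENNReal.ofReal_lt_ofReal_iff hε, X.ofReal_interpSeminorm hq] at hlt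
    have h1 : (T f g : V) - (X.i₀ (P.m₁₀ a b₀) + X.i₁ (P.m₁₁ a b₁)) =
        T f (g - e) - (X.i₀ (P.m₁₀ a b₀) + X.i₁ (P.m₁₁ a (b₁ - x))) := by
      rw [map_sub, AddSubgroupClass.coe_sub, hT₁ f e a x hf hx.symm, map_sub, map_sub]
      abel
    have h2 : X.i₀ b₀ + X.i₁ (b₁ - x) = ((g - e : X.interpSpace (1 - 1 / q) (ENNReal.ofReal q)) : V)
        := by
      rw [AddSubgroupClass.coe_sub, map_sub, hx, hg]
      abel
    rw [h1]
    calc _ ≤ X.K 1 (T f (g - e)) + X.K 1 (X.i₀ (P.m₁₀ a b₀) + X.i₁ (P.m₁₁ a (b₁ - x))) :=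
          X.K_sub_le _ _ _
      _ ≤ C * X.interpNorm (1 - 1 / q) (ENNReal.ofReal q) f *
            X.interpNorm (1 - 1 / q) (ENNReal.ofReal q) (g - e : X.interpSpace _ _) +
          2 * P.bound * ‖a‖ₑ *
            X.interpNorm (1 - 1 / q) (ENNReal.ofReal q) (g - e : X.interpSpace _ _) := by
          gcongr
          · exact (X.K_one_le_interpNorm hp _).trans (hT _ _)
          · refine (P.K_right_le one_pos a b₀ _).trans ?_
            rw [h2]
            gcongr
            exact X.K_one_le_interpNorm hq _
      _ = c * X.interpNorm (1 - 1 / q) (ENNReal.ofReal q) (g - e : X.interpSpace _ _) := by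
          rw [hc]; ring
      _ ≤ _ := by gcongr
  have hlim : Filter.Tendsto (fun ε : ℝ => c * ENNReal.ofReal ε) (nhdsWithin 0 (Ioi 0))
      (nhds (c * ENNReal.ofReal 0)) :=
    (ENNReal.Tendsto.const_mul (ENNReal.tendsto_ofReal Filter.tendsto_id)
      (Or.inr hctop)).mono_left nhdsWithin_le_nhds
  rw [ENNReal.ofReal_zero, mul_zero] at hlim
  have h0 := ge_of_tendsto hlim (Filter.eventually_of_mem self_mem_nhdsWithin key)
  exact sub_eq_zero.1 (X.eq_zero_of_K_eq_zero one_pos (nonpos_iff_eq_zero.1 h0))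

/-- Existence and uniqueness of the bounded extension of an operator of product type. -/
theorem exists_extension {p : ℝ} (hp : 1 < p) :
    ∃ C : ℝ≥0, ∀ (𝕜 V X₀ X₁ : Type*) [RCLike 𝕜]
      [AddCommGroup V] [Module 𝕜 V] [TopologicalSpace V]
      [IsTopologicalAddGroup V] [T2Space V]
      [NormedAddCommGroup X₀] [NormedSpace 𝕜 X₀] [CompleteSpace X₀]
      [NormedAddCommGroup X₁] [NormedSpace 𝕜 X₁] [CompleteSpace X₁]
      (X : BanachPair 𝕜 V X₀ X₁) (P : X.ProductOperator),
      ∃ T : X.interpSpace (1 - 1 / (2 * p)) (ENNReal.ofReal (2 * p)) →ₗ[𝕜]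
          X.interpSpace (1 - 1 / (2 * p)) (ENNReal.ofReal (2 * p)) →ₗ[𝕜]
          X.interpSpace (1 - 1 / p) (ENNReal.ofReal p),
        P.IsExtension T ∧
        (∀ f g : X.interpSpace (1 - 1 / (2 * p)) (ENNReal.ofReal (2 * p)),
          X.interpNorm (1 - 1 / p) (ENNReal.ofReal p) (T f g) ≤
            C * P.bound * X.interpNorm (1 - 1 / (2 * p)) (ENNReal.ofReal (2 * p)) f *
              X.interpNorm (1 - 1 / (2 * p)) (ENNReal.ofReal (2 * p)) g) ∧
        (∀ T' : X.interpSpace (1 - 1 / (2 * p)) (ENNReal.ofReal (2 * p)) →ₗ[𝕜]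
            X.interpSpace (1 - 1 / (2 * p)) (ENNReal.ofReal (2 * p)) →ₗ[𝕜]
            X.interpSpace (1 - 1 / p) (ENNReal.ofReal p),
          P.IsExtension T' →
          (∃ B : ℝ≥0, ∀ f g : X.interpSpace (1 - 1 / (2 * p)) (ENNReal.ofReal (2 * p)),
            X.interpNorm (1 - 1 / p) (ENNReal.ofReal p) (T' f g) ≤
              B * X.interpNorm (1 - 1 / (2 * p)) (ENNReal.ofReal (2 * p)) f *
                X.interpNorm (1 - 1 / (2 * p)) (ENNReal.ofReal (2 * p)) g) →
          T' = T) := by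
  have hq : 1 < 2 * p := by linarith
  obtain ⟨C, hC⟩ := exists_interpNorm_m₁₁_le hp
  refine ⟨C, ?_⟩
  intro 𝕜 V X₀ X₁ _ _ _ _ _ _ _ _ _ _ _ _ X P
  set Y := X.interpSpace (1 - 1 / (2 * p)) (ENNReal.ofReal (2 * p)) with hY
  set Z := X.interpSpace (1 - 1 / p) (ENNReal.ofReal p) with hZ
  set D := X.interpSpaceInter (1 - 1 / (2 * p)) (ENNReal.ofReal (2 * p)) with hD
  have hDr : ∀ d : D, ∃ a : X₁, X.i₁ a = ((d : Y) : V) := fun d => d.2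
  -- By injectivity of the embedding the preimage in X₁ is unique, so the chosen r is automatically
  -- linear.
  choose r hr using hDr
  have hradd : ∀ d e, r (d + e) = r d + r e := fun d e => X.inj₁ (by simp [hr])
  have hrsmul : ∀ (c : 𝕜) d, r (c • d) = c • r d := fun c d => X.inj₁ (by simp [hr])
  have hmem : ∀ d e : D, X.i₁ (P.m₁₁ (r d) (r e)) ∈ Z := by
    intro d e
    refine (hC 𝕜 V X₀ X₁ X P (r d) (r e)).trans_lt ?_
    rw [hr, hr]
    exact ENNReal.mul_lt_top (ENNReal.mul_lt_top (ENNReal.mul_lt_top (by simp) (by simp))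
      (d : Y).2) (e : Y).2
  have toENN : ∀ (B : ℝ≥0) (z : Z) (f g : Y), X.interpSeminorm hp z ≤
      B * X.interpSeminorm hq f * X.interpSeminorm hq g ↔
      X.interpNorm (1 - 1 / p) (ENNReal.ofReal p) z ≤
        B * X.interpNorm (1 - 1 / (2 * p)) (ENNReal.ofReal (2 * p)) f *
          X.interpNorm (1 - 1 / (2 * p)) (ENNReal.ofReal (2 * p)) g := by
    intro B z f g
    rw [← X.ofReal_interpSeminorm hp, ← X.ofReal_interpSeminorm hq, ← X.ofReal_interpSeminorm hq,
      ← ENNReal.ofReal_coe_nnreal, ← ENNReal.ofReal_mul (by positivity),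
      ← ENNReal.ofReal_mul (by positivity), ENNReal.ofReal_le_ofReal_iff (by positivity)]
  let B : D →ₗ[𝕜] D →ₗ[𝕜] Z := LinearMap.mk₂ 𝕜 (fun d e => ⟨X.i₁ (P.m₁₁ (r d) (r e)), hmem d e⟩)
    (fun d d' e => Subtype.ext (by simp [hradd]))
    (fun c d e => Subtype.ext (by simp [hrsmul]))
    (fun d e e' => Subtype.ext (by simp [hradd]))
    (fun c d e => Subtype.ext (by simp [hrsmul]))
  have hB : ∀ d e : D, X.interpSeminorm hp (B d e) ≤
      ((C * P.bound : ℝ≥0) : ℝ) * X.interpSeminorm hq d * X.interpSeminorm hq e := by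
    intro d e
    rw [toENN]
    have := hC 𝕜 V X₀ X₁ X P (r d) (r e)
    rw [hr, hr] at this
    push_cast
    exact this
  obtain ⟨T, hTB, hT, huniq⟩ := Seminorm.exists_bilinear_extension (X.interpSeminorm hq)
    (X.interpSeminorm hp) (X.eq_zero_of_interpSeminorm_eq_zero hq)
    (X.eq_zero_of_interpSeminorm_eq_zero hp) (X.interpSpace_complete hp)
    (fun y ε hε => X.interpSpaceInter_dense hq y hε) B hB
  have hT' : ∀ f g, X.interpNorm (1 - 1 / p) (ENNReal.ofReal p) (T f g) ≤
      (C * P.bound : ℝ≥0) * X.interpNorm (1 - 1 / (2 * p)) (ENNReal.ofReal (2 * p)) f *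
        X.interpNorm (1 - 1 / (2 * p)) (ENNReal.ofReal (2 * p)) g := fun f g =>
    (toENN _ _ _ _).1 (hT f g)
  have hT₁ : ∀ (f g : Y) (a b : X₁), (f : V) = X.i₁ a → (g : V) = X.i₁ b →
      (T f g : V) = X.i₁ (P.m₁₁ a b) := by
    intro f g a b hf hg
    have h1 := hTB ⟨f, a, hf.symm⟩ ⟨g, b, hg.symm⟩
    have ha : r ⟨f, a, hf.symm⟩ = a := X.inj₁ ((hr _).trans hf)
    have hb : r ⟨g, b, hg.symm⟩ = b := X.inj₁ ((hr _).trans hg)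
    have h2 : (B ⟨f, a, hf.symm⟩ ⟨g, b, hg.symm⟩ : V) = X.i₁ (P.m₁₁ (r _) (r _)) := rfl
    rw [ha, hb] at h2
    exact (congrArg Subtype.val h1).trans h2
  refine ⟨T, ⟨P.extension_right hp hq hT' hT₁, fun f g a₀ a₁ b hf hg => ?_⟩, fun f g => ?_, ?_⟩
  -- Exchanging the arguments reduces the second extension property to the first.
  · refine P.swap.extension_right hp hq (T := T.flip) (C := C * P.bound) (fun f g => ?_)
      (fun f g a b hf hg => hT₁ g f b a hg hf) g f b a₀ a₁ hg hf
    rw [mul_right_comm]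
    exact hT' g f
  · simpa using hT' f g
  · rintro T' hext ⟨M, hM⟩
    refine huniq T' M (fun f g => (toENN _ _ _ _).2 (hM f g)) fun d e => Subtype.ext ?_
    -- Uniqueness needs agreement only on X₁ × X₁, that is, with zero X₀-part.
    have h := hext.1 (d : Y) (e : Y) (r d) 0 (r e) (hr d).symm (by simp [hr])
    rw [h]
    simp [B]

/-- The extension of an operator of product type, with the Gagliardo form of its bound. -/
theorem exists_extension_gagliardo {p : ℝ} (hp : 1 < p) :
    ∃ C : ℝ≥0, ∀ (𝕜 V X₀ X₁ : Type*) [RCLike 𝕜]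
      [AddCommGroup V] [Module 𝕜 V] [TopologicalSpace V]
      [IsTopologicalAddGroup V] [T2Space V]
      [NormedAddCommGroup X₀] [NormedSpace 𝕜 X₀] [CompleteSpace X₀]
      [NormedAddCommGroup X₁] [NormedSpace 𝕜 X₁] [CompleteSpace X₁]
      (X : BanachPair 𝕜 V X₀ X₁) (P : X.ProductOperator),
      ∃ T : X.interpSpace (1 - 1 / (2 * p)) (ENNReal.ofReal (2 * p)) →ₗ[𝕜]
          X.interpSpace (1 - 1 / (2 * p)) (ENNReal.ofReal (2 * p)) →ₗ[𝕜]
          X.interpSpace (1 - 1 / p) (ENNReal.ofReal p),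
        P.IsExtension T ∧
        (∀ f g : X.interpSpace (1 - 1 / (2 * p)) (ENNReal.ofReal (2 * p)),
          X.interpNorm (1 - 1 / p) (ENNReal.ofReal p) (T f g) ≤
            C * P.bound * X.interpNorm (1 - 1 / (2 * p)) (ENNReal.ofReal (2 * p)) f *
              X.interpNorm (1 - 1 / (2 * p)) (ENNReal.ofReal (2 * p)) g) ∧
        (∀ T' : X.interpSpace (1 - 1 / (2 * p)) (ENNReal.ofReal (2 * p)) →ₗ[𝕜]
            X.interpSpace (1 - 1 / (2 * p)) (ENNReal.ofReal (2 * p)) →ₗ[𝕜]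
            X.interpSpace (1 - 1 / p) (ENNReal.ofReal p),
          P.IsExtension T' →
          (∃ B : ℝ≥0, ∀ f g : X.interpSpace (1 - 1 / (2 * p)) (ENNReal.ofReal (2 * p)),
            X.interpNorm (1 - 1 / p) (ENNReal.ofReal p) (T' f g) ≤
              B * X.interpNorm (1 - 1 / (2 * p)) (ENNReal.ofReal (2 * p)) f *
                X.interpNorm (1 - 1 / (2 * p)) (ENNReal.ofReal (2 * p)) g) →
          T' = T) ∧
        (∀ f g : V,
          f ∈ X.interpSpace (1 - 1 / p) (ENNReal.ofReal p) → X.gagliardoNorm₁ 1 ∞ f < ∞ →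
          g ∈ X.interpSpace (1 - 1 / p) (ENNReal.ofReal p) → X.gagliardoNorm₁ 1 ∞ g < ∞ →
          ∃ (hf : f ∈ X.interpSpace (1 - 1 / (2 * p)) (ENNReal.ofReal (2 * p)))
            (hg : g ∈ X.interpSpace (1 - 1 / (2 * p)) (ENNReal.ofReal (2 * p))),
            X.interpNorm (1 - 1 / p) (ENNReal.ofReal p) (T ⟨f, hf⟩ ⟨g, hg⟩) ≤
              C * P.bound *
                (X.interpNorm (1 - 1 / p) (ENNReal.ofReal p) f * X.gagliardoNorm₁ 1 ∞ g +
                  X.interpNorm (1 - 1 / p) (ENNReal.ofReal p) g * X.gagliardoNorm₁ 1 ∞ f)) := by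
  obtain ⟨C₁, hC₁⟩ := exists_interpNorm_le_gagliardoNorm hp
  obtain ⟨C₂, hC₂⟩ := exists_extension hp
  refine ⟨max C₂ (C₂ * C₁ ^ 2), ?_⟩
  intro 𝕜 V X₀ X₁ _ _ _ _ _ _ _ _ _ _ _ _ X P
  obtain ⟨T, hT, hTle, huniq⟩ := hC₂ 𝕜 V X₀ X₁ X P
  refine ⟨T, hT, fun f g => (hTle f g).trans ?_, huniq, fun f g hf hfγ hg hgγ => ?_⟩
  · gcongr
    exact le_max_left _ _
  · have hmem : ∀ h : V, h ∈ X.interpSpace (1 - 1 / p) (ENNReal.ofReal p) →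
        X.gagliardoNorm₁ 1 ∞ h < ∞ →
        h ∈ X.interpSpace (1 - 1 / (2 * p)) (ENNReal.ofReal (2 * p)) := by
      intro h hh hγ
      refine (hC₁ 𝕜 V X₀ X₁ X h hh).trans_lt ?_
      exact ENNReal.mul_lt_top (ENNReal.mul_lt_top (by simp)
        (ENNReal.rpow_lt_top_of_nonneg (by norm_num) (ne_of_lt hh)))
        (ENNReal.rpow_lt_top_of_nonneg (by norm_num) hγ.ne)
    refine ⟨hmem f hf hfγ, hmem g hg hgγ, (hTle _ _).trans ?_⟩
    have h1 := hC₁ 𝕜 V X₀ X₁ X f hf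
    have h2 := hC₁ 𝕜 V X₀ X₁ X g hg
    rw [mul_assoc (C₂ * P.bound : ℝ≥0∞)]
    refine (mul_le_mul_right (ENNReal.geometric_mul_le h1 h2) _).trans ?_
    calc _ = ((C₂ * C₁ ^ 2 : ℝ≥0) : ℝ≥0∞) * P.bound *
          (X.interpNorm (1 - 1 / p) (ENNReal.ofReal p) f * X.gagliardoNorm₁ 1 ∞ g +
            X.interpNorm (1 - 1 / p) (ENNReal.ofReal p) g * X.gagliardoNorm₁ 1 ∞ f) := by
          push_cast
          ring
      _ ≤ _ := by
          gcongr
          exact le_max_right _ _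

end ProductOperator

end BanachPair

/-! ### Rearrangements and the product inequality in L^p -/

section Rearrangement

variable {Ω E : Type*} [MeasurableSpace Ω] [NormedAddCommGroup E]

/-- The infimum defining f* is attained: {|f| > s} is the increasing union of the sets {|f| > s +
1/n}, and continuity of the measure from below applies. -/
theorem lt_rearrangement_iff (f : Ω → E) (μ : Measure Ω) (t : ℝ) (s : ℝ≥0∞) :
    s < rearrangement f μ t ↔ ENNReal.ofReal t < μ {x | s < ‖f x‖ₑ} := by
  refine ⟨fun h => ?_, fun h => ?_⟩
  · by_contra hcon
    have h1 : rearrangement f μ t ≤ s := sInf_le (not_lt.1 hcon)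
    exact h1.not_gt h
  · by_contra hcon
    rw [not_lt] at hcon
    have hs : s ≠ ∞ := by
      rintro rfl
      simp at h
    have hunion : {x | s < ‖f x‖ₑ} = ⋃ n : ℕ, {x | s + (n : ℝ≥0∞)⁻¹ < ‖f x‖ₑ} := by
      ext x
      simp only [mem_ofPred_eq, mem_iUnion]
      refine ⟨fun hx => ?_, fun ⟨n, hn⟩ => le_self_add.trans_lt hn⟩
      obtain ⟨n, hn⟩ := ENNReal.exists_inv_nat_lt (tsub_pos_of_lt hx).ne'
      exact ⟨n, by rw [add_comm]; exact lt_tsub_iff_right.1 hn⟩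
    have hmono : Monotone fun n : ℕ => {x | s + (n : ℝ≥0∞)⁻¹ < ‖f x‖ₑ} := by
      intro n m hnm x hx
      refine lt_of_le_of_lt ?_ (show s + (n : ℝ≥0∞)⁻¹ < ‖f x‖ₑ from hx)
      gcongr
    rw [hunion, hmono.measure_iUnion, lt_iSup_iff] at h
    obtain ⟨n, hn⟩ := h
    have h1 : rearrangement f μ t < s + (n : ℝ≥0∞)⁻¹ :=
      hcon.trans_lt (ENNReal.lt_add_right hs (by simp))
    obtain ⟨r, hr, hrlt⟩ := sInf_lt_iff.1 h1
    refine hn.not_ge (le_trans (measure_mono fun x hx => ?_) hr)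
    exact hrlt.trans hx

theorem rearrangement_antitone (f : Ω → E) (μ : Measure Ω) : Antitone (rearrangement f μ) :=
  fun _ _ hst => sInf_le_sInf fun _ hr => le_trans hr (ENNReal.ofReal_le_ofReal hst)

/-- Bounding f* from below by f*(t) on (0, t] and by f*(2t) on (t, 2t] gives f**(2t) ≥ (f*(t) +
f*(2t))/2, while f**(2t) ≤ f*(2t) + ‖f‖_{L(∞,∞)}; hence the factor 2. -/
theorem rearrangement_le_two_mul_add (f : Ω → E) (μ : Measure Ω) {t : ℝ} (ht : 0 < t) :
    rearrangement f μ t ≤ rearrangement f μ (2 * t) + 2 * normLInftyInfty f μ := by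
  set c := rearrangement f μ (2 * t) with hc
  set γ := normLInftyInfty f μ with hγ
  by_cases hctop : c = ∞
  · simp [hctop]
  have h2t : 0 < 2 * t := by linarith
  have h1 : maximalRearrangement f μ (2 * t) ≤ c + γ := by
    rw [← tsub_le_iff_left]
    exact le_iSup₂_of_le (2 * t) h2t le_rfl
  have hint : ENNReal.ofReal t * rearrangement f μ t + ENNReal.ofReal t * c ≤
      ∫⁻ s in Ioc 0 (2 * t), rearrangement f μ s := by
    rw [← Ioc_union_Ioc_eq_Ioc ht.le (by linarith : t ≤ 2 * t),
      lintegral_union measurableSet_Ioc (by simp)]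
    gcongr
    · calc ENNReal.ofReal t * rearrangement f μ t = ∫⁻ _ in Ioc 0 t, rearrangement f μ t := by
            simp [mul_comm]
        _ ≤ _ := setLIntegral_mono (rearrangement_antitone f μ).measurable
            fun s hs => rearrangement_antitone f μ hs.2
    · calc ENNReal.ofReal t * c = ∫⁻ _ in Ioc t (2 * t), c := by
            rw [setLIntegral_const, Real.volume_Ioc, mul_comm]
            congr 2
            ring
        _ ≤ _ := setLIntegral_mono (rearrangement_antitone f μ).measurable
            fun s hs => rearrangement_antitone f μ hs.2
  have h2t0 : ENNReal.ofReal (2 * t) ≠ 0 := by simpa using ht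
  rw [maximalRearrangement, mul_comm, ← div_eq_mul_inv,
    ENNReal.div_le_iff h2t0 ENNReal.ofReal_ne_top] at h1
  have ht0 : ENNReal.ofReal t ≠ 0 := by simpa using ht
  have h3 : ENNReal.ofReal t * (rearrangement f μ t + c) ≤
      ENNReal.ofReal t * (c + 2 * γ + c) := by
    rw [mul_add]
    refine (hint.trans h1).trans_eq ?_
    rw [ENNReal.ofReal_mul (by norm_num), ENNReal.ofReal_ofNat]
    ring
  rw [ENNReal.mul_le_mul_iff_right ht0 ENNReal.ofReal_ne_top] at h3
  exact (ENNReal.add_le_add_iff_right hctop).1 h3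

/-- If f*(t) = ∞, every level set {|f| > s} has measure above t, and Chebyshev bounds all s^p by the
same finite number. -/
theorem rearrangement_ne_top {f : Ω → E} {μ : Measure Ω} {p : ℝ} (hp : 0 < p)
    (hf : AEStronglyMeasurable f μ) (hfin : ∫⁻ x, ‖f x‖ₑ ^ p ∂μ ≠ ∞) {t : ℝ} (ht : 0 < t) :
    rearrangement f μ t ≠ ∞ := by
  intro htop
  have ht0 : ENNReal.ofReal t ≠ 0 := by simpa using ht
  have h : ∀ s : ℝ≥0∞, s ≠ ∞ → s ^ p ≤ (∫⁻ x, ‖f x‖ₑ ^ p ∂μ) / ENNReal.ofReal t := by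
    intro s hs
    have h1 := (lt_rearrangement_iff f μ t s).1 (htop ▸ hs.lt_top)
    rw [ENNReal.le_div_iff_mul_le (Or.inl ht0) (Or.inl ENNReal.ofReal_ne_top)]
    calc s ^ p * ENNReal.ofReal t ≤ s ^ p * μ {x | s ^ p ≤ ‖f x‖ₑ ^ p} := by
          gcongr
          refine h1.le.trans (measure_mono fun x hx => ?_)
          have : s < ‖f x‖ₑ := hx
          simp only [mem_ofPred_eq]
          gcongr
      _ ≤ _ := mul_meas_ge_le_lintegral₀ (hf.enorm.pow_const p) _
  have hI : (∫⁻ x, ‖f x‖ₑ ^ p ∂μ) / ENNReal.ofReal t ≠ ∞ := ENNReal.div_ne_top hfin ht0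
  set I := (∫⁻ x, ‖f x‖ₑ ^ p ∂μ) / ENNReal.ofReal t
  have h2 := h ((I + 1) ^ (1 / p))
    (ENNReal.rpow_ne_top_of_nonneg (by positivity) (by simpa using hI))
  rw [← ENNReal.rpow_mul, one_div_mul_cancel hp.ne', ENNReal.rpow_one] at h2
  exact h2.not_gt (ENNReal.lt_add_right hI one_ne_zero)

theorem volume_restrict_ofReal_lt (m : ℝ≥0∞) :
    (volume.restrict (Ioi (0 : ℝ))) {t | ENNReal.ofReal t < m} = m := by
  have hmeas : MeasurableSet {t : ℝ | ENNReal.ofReal t < m} :=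
    measurableSet_lt ENNReal.measurable_ofReal measurable_const
  rw [Measure.restrict_apply hmeas]
  by_cases hm : m = ∞
  · simp [hm]
  · have : {t : ℝ | ENNReal.ofReal t < m} ∩ Ioi 0 = Ioo 0 m.toReal := by
      ext t
      simp only [mem_inter_iff, mem_ofPred_eq, mem_Ioi, mem_Ioo]
      refine ⟨fun ⟨h, h0⟩ => ⟨h0, ?_⟩, fun ⟨h0, h⟩ => ⟨?_, h0⟩⟩
      · exact (ENNReal.ofReal_lt_iff_lt_toReal h0.le hm).1 h
      · exact (ENNReal.ofReal_lt_iff_lt_toReal h0.le hm).2 h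
    rw [this, Real.volume_Ioo, sub_zero, ENNReal.ofReal_toReal hm]

/-- A function and its rearrangement are equimeasurable. -/
theorem lintegral_rearrangement_rpow {f : Ω → E} {μ : Measure Ω} {q : ℝ} (hq : 0 < q)
    (hf : AEStronglyMeasurable f μ) (hfin : ∀ t, 0 < t → rearrangement f μ t ≠ ∞) :
    ∫⁻ t in Ioi 0, rearrangement f μ t ^ q = ∫⁻ x, ‖f x‖ₑ ^ q ∂μ := by
  have hl : ∫⁻ t in Ioi 0, rearrangement f μ t ^ q =
      ∫⁻ t in Ioi 0, ENNReal.ofReal ((rearrangement f μ t).toReal ^ q) := by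
    refine setLIntegral_congr_fun measurableSet_Ioi fun t ht => ?_
    rw [← ENNReal.ofReal_rpow_of_nonneg ENNReal.toReal_nonneg hq.le,
      ENNReal.ofReal_toReal (hfin t ht)]
  have hr : ∫⁻ x, ‖f x‖ₑ ^ q ∂μ = ∫⁻ x, ENNReal.ofReal (‖f x‖ ^ q) ∂μ := by
    refine lintegral_congr fun x => ?_
    rw [← ENNReal.ofReal_rpow_of_nonneg (norm_nonneg _) hq.le, ofReal_norm]
  rw [hl, hr, lintegral_eq_lintegral_meas_lt _
      (Filter.Eventually.of_forall fun t => Real.rpow_nonneg ENNReal.toReal_nonneg q)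
      ((rearrangement_antitone f μ).measurable.ennreal_toReal.pow_const q).aemeasurable,
    lintegral_eq_lintegral_meas_lt _
      (Filter.Eventually.of_forall fun x => Real.rpow_nonneg (norm_nonneg _) q)
      (hf.norm.aemeasurable.pow_const q)]
  refine setLIntegral_congr_fun measurableSet_Ioi fun s (hs : 0 < s) => ?_
  set r : ℝ := s ^ (1 / q) with hrdef
  have hr0 : 0 ≤ r := by positivity
  have hrq : r ^ q = s := by
    rw [hrdef, ← Real.rpow_mul hs.le, one_div_mul_cancel hq.ne', Real.rpow_one]
  have hset : {x | s < ‖f x‖ ^ q} = {x | ENNReal.ofReal r < ‖f x‖ₑ} := by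
    ext x
    simp only [mem_ofPred_eq]
    rw [← hrq, Real.rpow_lt_rpow_iff hr0 (norm_nonneg _) hq, ← ofReal_norm,
      ENNReal.ofReal_lt_ofReal_iff_of_nonneg hr0]
  -- The measure of the level set of f is rewritten as the length of {t > 0 : t < μ{|f| > r}}, which
  -- by `lt_rearrangement_iff` is the level set of f*.
  rw [hset, ← volume_restrict_ofReal_lt (μ {x | ENNReal.ofReal r < ‖f x‖ₑ})]
  refine measure_congr ?_
  filter_upwards [ae_restrict_mem measurableSet_Ioi] with t ht
  refine propext ?_
  change s < (rearrangement f μ t).toReal ^ q ↔ ENNReal.ofReal t < μ {x | ENNReal.ofReal r < ‖f x‖ₑ}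
  rw [← lt_rearrangement_iff, ← hrq, Real.rpow_lt_rpow_iff hr0 ENNReal.toReal_nonneg hq,
    ENNReal.ofReal_lt_iff_lt_toReal hr0 (hfin t ht)]

/-- Interpolation between `L^p` and `L(∞, ∞)`. -/
theorem exists_lintegral_rpow_two_mul_le_normLInftyInfty {p : ℝ} (hp : 1 < p) :
    ∃ C : ℝ≥0, ∀ (Ω E : Type*) [MeasurableSpace Ω] [NormedAddCommGroup E] (μ : Measure Ω)
      (f : Ω → E), MemLp f (ENNReal.ofReal p) μ →
      (∫⁻ x, ‖f x‖ₑ ^ (2 * p) ∂μ) ^ (1 / (2 * p)) ≤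
        C * eLpNorm f (ENNReal.ofReal p) μ ^ (1 / 2 : ℝ) *
          (2 * normLInftyInfty f μ) ^ (1 / 2 : ℝ) := by
  have hp0 : 0 < p := by linarith
  obtain ⟨C, hC⟩ := exists_lintegral_Lp_two_mul_le hp0
  refine ⟨C, fun Ω E _ _ μ f hf => ?_⟩
  have hnorm : eLpNorm f (ENNReal.ofReal p) μ = (∫⁻ x, ‖f x‖ₑ ^ p ∂μ) ^ (1 / p) := by
    rw [eLpNorm_eq_lintegral_rpow_enorm_toReal (by simpa using hp0) ENNReal.ofReal_ne_top,
      ENNReal.toReal_ofReal hp0.le]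
  have hfin : ∫⁻ x, ‖f x‖ₑ ^ p ∂μ ≠ ∞ := by
    have h := hf.2
    rw [hnorm, ENNReal.rpow_lt_top_iff_of_pos (by positivity)] at h
    exact h.ne
  have htop : ∀ t, 0 < t → rearrangement f μ t ≠ ∞ := fun t ht =>
    rearrangement_ne_top hp0 hf.1 hfin ht
  have h := hC (rearrangement f μ) (2 * normLInftyInfty f μ)
    (rearrangement_antitone f μ).measurable (fun t ht => rearrangement_le_two_mul_add f μ ht)
  rw [lintegral_rearrangement_rpow hp0 hf.1 htop,
    lintegral_rearrangement_rpow (by positivity) hf.1 htop] at h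
  rw [hnorm]
  exact h hfin

/-- The product inequality in `L^p` with the `L(∞, ∞)`-functional. -/
theorem exists_eLpNorm_mul_le {p : ℝ} (hp : 1 < p) :
    ∃ C : ℝ≥0, ∀ (𝕜 Ω : Type*) [RCLike 𝕜] [MeasurableSpace Ω] (μ : Measure Ω) (f g : Ω → 𝕜),
      MemLp f (ENNReal.ofReal p) μ → MemLp g (ENNReal.ofReal p) μ →
      eLpNorm (fun x => f x * g x) (ENNReal.ofReal p) μ ≤
        C * (eLpNorm f (ENNReal.ofReal p) μ * normLInftyInfty g μ +
          eLpNorm g (ENNReal.ofReal p) μ * normLInftyInfty f μ) := by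
  have hp0 : 0 < p := by linarith
  obtain ⟨C, hC⟩ := exists_lintegral_rpow_two_mul_le_normLInftyInfty hp
  -- The factor 2 comes from the drop bound 2 ‖·‖_{L(∞,∞)} of the rearrangement.
  refine ⟨2 * C ^ 2, fun 𝕜 Ω _ _ μ f g hf hg => ?_⟩
  rw [eLpNorm_eq_lintegral_rpow_enorm_toReal (by simpa using hp0) ENNReal.ofReal_ne_top,
    ENNReal.toReal_ofReal hp0.le]
  simp only [enorm_mul]
  refine (lintegral_Lp_mul_le hp0 hf.1.enorm hg.1.enorm).trans ?_
  refine (ENNReal.geometric_mul_le (hC Ω 𝕜 μ f hf) (hC Ω 𝕜 μ g hg)).trans (le_of_eq ?_)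
  push_cast
  ring

end Rearrangement

/-! ### The three statements together -/

theorem mainTheorem7 (p : ℝ) (hp : 1 < p) (θ : ℝ) (hθ : θ = 1 / p) :
    (∃ C : ℝ≥0, ∀ (𝕜 V X₀ X₁ : Type*) [RCLike 𝕜]
      [AddCommGroup V] [Module 𝕜 V] [TopologicalSpace V]
      [IsTopologicalAddGroup V] [ContinuousSMul 𝕜 V] [T2Space V]
      [NormedAddCommGroup X₀] [NormedSpace 𝕜 X₀] [CompleteSpace X₀]
      [NormedAddCommGroup X₁] [NormedSpace 𝕜 X₁] [CompleteSpace X₁]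
      (X : BanachPair 𝕜 V X₀ X₁) (f : V),
      f ∈ X.interpSpace (1 - θ) (ENNReal.ofReal p) →
      X.interpNorm (1 - θ / 2) (ENNReal.ofReal (2 * p)) f ≤
        C * X.interpNorm (1 - θ) (ENNReal.ofReal p) f ^ (1 / 2 : ℝ) *
          X.gagliardoNorm₁ 1 ∞ f ^ (1 / 2 : ℝ)) ∧
    (∃ C : ℝ≥0, ∀ (𝕜 V X₀ X₁ : Type*) [RCLike 𝕜]
      [AddCommGroup V] [Module 𝕜 V] [TopologicalSpace V]
      [IsTopologicalAddGroup V] [ContinuousSMul 𝕜 V] [T2Space V]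
      [NormedAddCommGroup X₀] [NormedSpace 𝕜 X₀] [CompleteSpace X₀]
      [NormedAddCommGroup X₁] [NormedSpace 𝕜 X₁] [CompleteSpace X₁]
      (X : BanachPair 𝕜 V X₀ X₁) (P : X.ProductOperator),
      ∃ T : X.interpSpace (1 - θ / 2) (ENNReal.ofReal (2 * p)) →ₗ[𝕜]
          X.interpSpace (1 - θ / 2) (ENNReal.ofReal (2 * p)) →ₗ[𝕜]
          X.interpSpace (1 - θ) (ENNReal.ofReal p),
        P.IsExtension T ∧
        (∀ f g : X.interpSpace (1 - θ / 2) (ENNReal.ofReal (2 * p)),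
          X.interpNorm (1 - θ) (ENNReal.ofReal p) (T f g) ≤
            C * P.bound * X.interpNorm (1 - θ / 2) (ENNReal.ofReal (2 * p)) f *
              X.interpNorm (1 - θ / 2) (ENNReal.ofReal (2 * p)) g) ∧
        (∀ T' : X.interpSpace (1 - θ / 2) (ENNReal.ofReal (2 * p)) →ₗ[𝕜]
            X.interpSpace (1 - θ / 2) (ENNReal.ofReal (2 * p)) →ₗ[𝕜]
            X.interpSpace (1 - θ) (ENNReal.ofReal p),
          P.IsExtension T' →
          (∃ B : ℝ≥0, ∀ f g : X.interpSpace (1 - θ / 2) (ENNReal.ofReal (2 * p)),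
            X.interpNorm (1 - θ) (ENNReal.ofReal p) (T' f g) ≤
              B * X.interpNorm (1 - θ / 2) (ENNReal.ofReal (2 * p)) f *
                X.interpNorm (1 - θ / 2) (ENNReal.ofReal (2 * p)) g) →
          T' = T) ∧
        (∀ f g : V,
          f ∈ X.interpSpace (1 - θ) (ENNReal.ofReal p) → X.gagliardoNorm₁ 1 ∞ f < ∞ →
          g ∈ X.interpSpace (1 - θ) (ENNReal.ofReal p) → X.gagliardoNorm₁ 1 ∞ g < ∞ →
          ∃ (hf : f ∈ X.interpSpace (1 - θ / 2) (ENNReal.ofReal (2 * p)))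
            (hg : g ∈ X.interpSpace (1 - θ / 2) (ENNReal.ofReal (2 * p))),
            X.interpNorm (1 - θ) (ENNReal.ofReal p) (T ⟨f, hf⟩ ⟨g, hg⟩) ≤
              C * P.bound *
                (X.interpNorm (1 - θ) (ENNReal.ofReal p) f * X.gagliardoNorm₁ 1 ∞ g +
                  X.interpNorm (1 - θ) (ENNReal.ofReal p) g * X.gagliardoNorm₁ 1 ∞ f))) ∧
    (∃ C : ℝ≥0, ∀ (𝕜 Ω : Type*) [RCLike 𝕜] [MeasurableSpace Ω] (μ : Measure Ω) (f g : Ω → 𝕜),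
      MemLp f (ENNReal.ofReal p) μ → MemLp g (ENNReal.ofReal p) μ →
      eLpNorm (fun x => f x * g x) (ENNReal.ofReal p) μ ≤
        C * (eLpNorm f (ENNReal.ofReal p) μ * normLInftyInfty g μ +
          eLpNorm g (ENNReal.ofReal p) μ * normLInftyInfty f μ)) := by
  subst hθ
  -- The exponent takes the form 1 - 1/q with q = 2p, in which the norm is an L^q norm of the
  -- average.
  have h : 1 - 1 / p / 2 = 1 - 1 / (2 * p) := by
    have : p ≠ 0 := by linarith
    field_simp
  rw [h]
  obtain ⟨C₁, hC₁⟩ := BanachPair.exists_interpNorm_le_gagliardoNorm hp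
  obtain ⟨C₂, hC₂⟩ := BanachPair.ProductOperator.exists_extension_gagliardo hp
  refine ⟨⟨C₁, ?_⟩, ⟨C₂, ?_⟩, exists_eLpNorm_mul_le hp⟩
  · intro 𝕜 V X₀ X₁ _ _ _ _ _ _ _ _ _ _ _ _ _ X f hf
    exact hC₁ 𝕜 V X₀ X₁ X f hf
  · intro 𝕜 V X₀ X₁ _ _ _ _ _ _ _ _ _ _ _ _ _ X P
    exact hC₂ 𝕜 V X₀ X₁ X P
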